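/- Let $\Sigma$ be a smooth surface, $p:\Sigma\to\mathbb R^3$ a smooth embedding with a global smooth unit normal field $\vec N$ (so $\Sigma$ is orientable), and let $a>0$ be such that $$\tilde p:\Omega=\Sigma\times[-a,a]\to\mathbb R^3,\qquad \tilde p(x,t)=p(x)+t\vec N_x,$$ is a smooth embedding. Let $ds^2_\Omega$ be the pull-back of the Euclidean metric by $\tilde p$; $(\Omega,ds^2_\Omega)$ is the quantum layer over $\Sigma$, with volume $d\Omega$. Assume that $\Sigma$ is asymptotically flat: the norm of its second fundamental form (in the metric induced by $p$) goes to zero at infinity, that is, for every $\epsilon>0$ it is at most $\epsilon$ outside some compact subset of $\Sigma$. ($\Sigma$ is typically complete, non-compact and not totally geodesic, but this is not required.) Let $C_0^\infty(\Omega)$ be the smooth functions with compact support in the interior $\Sigma\times(-a,a)$, and let $\Delta$ be the (positive) Dirichlet Laplacian of $\Omega$: the self-adjoint operator in $L^2(\Omega,d\Omega)$ associated with the closure of the quadratic form $\int_\Omega|\nabla f|^2\,d\Omega$, $f\in C_0^\infty(\Omega)$. Its essential spectrum is its spectrum without the isolated eigenvalues of finite multiplicity. Then the bottom of the essential spectrum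 satisfies $$\inf\sigma_{\mathrm{ess}}(\Delta)\ \ge\ \frac{\pi^2}{4a^2},$$ and likewise the variational quantity that expresses it satisfies $$\sup_{K}\ \inf_{0\ne f\in C_0^\infty(\Omega\setminus K)}\frac{\int_\Omega|\nabla f|^2\,d\Omega}{\int_\Omega f^2\,d\Omega}\ \ge\ \frac{\pi^2}{4a^2},$$ where $K$ runs over the compact subsets of $\Omega$ and $C_0^\infty(\Omega\setminus K)$ is the set of $f\in C_0^\infty(\Omega)$ with support disjoint from $K$. (The infimum of the empty set is $+\infty$.) -/

import Mathlib

open MeasureTheory Filter Topology Set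
open scoped Manifold ContDiff RealInnerProductSpace

noncomputable section

namespace QuantumLayer

/-- The Euclidean plane, the model space of surfaces. -/
abbrev E2 : Type := EuclideanSpace ℝ (Fin 2)

/-- The ambient Euclidean space `ℝ³`. -/
abbrev E3 : Type := EuclideanSpace ℝ (Fin 3)

/-! ### Spectrum of an unbounded operator, given by its graph -/

section Spectrum

variable {H : Type*} [NormedAddCommGroup H] [InnerProductSpace ℝ H]

/-- The resolvent set of the operator `A` in `H` with graph `A = {(u, A u)}`: the `c` for which
`A - c` has an everywhere defined bounded inverse `R`, that is, `A u - c u = f ↔ u = R f`. -/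
def resolventSet (A : Submodule ℝ (H × H)) : Set ℝ :=
  {c | ∃ R : H →L[ℝ] H, ∀ u f : H, (u, f + c • u) ∈ A ↔ u = R f}

/-- The (real) spectrum; a self-adjoint operator has no other spectrum. -/
def spectrum (A : Submodule ℝ (H × H)) : Set ℝ := (resolventSet A)ᶜ

/-- The eigenspace `{u | A u = c u}`. -/
def eigenspace (A : Submodule ℝ (H × H)) (c : ℝ) : Submodule ℝ H :=
  A.comap (LinearMap.prod LinearMap.id (c • LinearMap.id))

/-- The discrete spectrum: isolated points of the spectrum that are eigenvalues of finite
multiplicity. -/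
def discreteSpectrum (A : Submodule ℝ (H × H)) : Set ℝ :=
  {c ∈ spectrum A | ¬ AccPt c (𝓟 (spectrum A)) ∧ eigenspace A c ≠ ⊥ ∧
    FiniteDimensional ℝ (eigenspace A c)}

/-- The essential spectrum of a self-adjoint operator: the rest of the spectrum. -/
def essentialSpectrum (A : Submodule ℝ (H × H)) : Set ℝ := spectrum A \ discreteSpectrum A

/-- The bottom of the essential spectrum (`⊤` if the essential spectrum is empty). -/
def bottomEssentialSpectrum (A : Submodule ℝ (H × H)) : EReal :=
  ⨅ c ∈ essentialSpectrum A, (c : EReal)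

end Spectrum

/-! ### The layer over a surface and its Riemannian metric -/

section Geometry

variable {S : Type*} [TopologicalSpace S] [ChartedSpace E2 S]

/-- The map `p̃ (x, t) = p x + t N x`. -/
def layerMap (p N : S → E3) (z : S × ℝ) : E3 := p z.1 + z.2 • N z.1

/-- The layer `Ω = Σ × [-a, a]`. -/
def layer (S : Type*) (a : ℝ) : Set (S × ℝ) := univ ×ˢ Icc (-a) a

/-- The interior `Σ × (-a, a)` of the layer. -/
def openLayer (S : Type*) (a : ℝ) : Set (S × ℝ) := univ ×ˢ Ioo (-a) a

/-- The differential of a map on the surface. -/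
def surfaceDeriv (p : S → E3) (x : S) : E2 →L[ℝ] E3 := mfderiv (𝓡 2) 𝓘(ℝ, E3) p x

/-- The differential of `p̃` at a point of `Σ × ℝ`. -/
def layerDeriv (p N : S → E3) (z : S × ℝ) : E2 × ℝ →L[ℝ] E3 :=
  mfderiv ((𝓡 2).prod 𝓘(ℝ, ℝ)) 𝓘(ℝ, E3) (layerMap p N) z

/-- The second fundamental form `B (X, Y) = -⟨dN X, dp Y⟩` of the surface `p` with unit
normal `N`. -/
def secondFundamentalForm (p N : S → E3) (x : S) (X Y : E2) : ℝ :=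
  -⟪surfaceDeriv N x X, surfaceDeriv p x Y⟫

/-- The second fundamental form, measured in the metric induced by `p`, goes to zero at infinity,
that is, it is small outside large compact sets. -/
def AsymptoticallyFlat (p N : S → E3) : Prop :=
  ∀ ε > 0, ∀ᶠ x in cocompact S, ∀ X Y : E2,
    |secondFundamentalForm p N x X Y| ≤ ε * ‖surfaceDeriv p x X‖ * ‖surfaceDeriv p x Y‖

/-- `p : Σ → ℝ³` is a smooth surface with global smooth unit normal field `N` (so `Σ` is
orientable), and `p̃ (x, t) = p x + t N x` is a smooth embedding of `Σ × [-a, a]` in `ℝ³`: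
an immersion that is a homeomorphism onto its image. (Restricted to `t = 0` this says that
`p` itself is an embedding.) -/
structure IsQuantumLayer (p N : S → E3) (a : ℝ) : Prop where
  contMDiff_p : ContMDiff (𝓡 2) 𝓘(ℝ, E3) ∞ p
  contMDiff_N : ContMDiff (𝓡 2) 𝓘(ℝ, E3) ∞ N
  norm_N : ∀ x, ‖N x‖ = 1
  normal_N : ∀ x X, ⟪surfaceDeriv p x X, N x⟫ = 0
  pos : 0 < a
  immersion : ∀ z ∈ layer S a, Function.Injective (layerDeriv p N z)
  embedding : IsEmbedding ((layer S a).domRestrict (layerMap p N))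

/-- The metric `ds²_Ω`: the pull-back of the Euclidean metric by `p̃`. -/
def layerMetric (p N : S → E3) (z : S × ℝ) (X Y : E2 × ℝ) : ℝ :=
  ⟪layerDeriv p N z X, layerDeriv p N z Y⟫

/-- The differential of a real function on `Σ × ℝ`. -/
def differential (f : S × ℝ → ℝ) (z : S × ℝ) : E2 × ℝ →L[ℝ] ℝ :=
  mfderiv ((𝓡 2).prod 𝓘(ℝ, ℝ)) 𝓘(ℝ, ℝ) f z

/-- The gradient of `f` for the metric `ds²_Ω`, see `layerMetric_layerGradient`: the vector that
`dp̃` maps to the Euclidean vector dual to `df ∘ (dp̃)⁻¹`. -/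
def layerGradient (p N : S → E3) (f : S × ℝ → ℝ) (z : S × ℝ) : E2 × ℝ :=
  (layerDeriv p N z).inverse ((InnerProductSpace.toDual ℝ E3).symm
    ((differential f z).comp (layerDeriv p N z).inverse))

/-- Where `p̃` is an immersion, `layerGradient p N f z` is the Riemannian gradient: it represents
`df` in the metric `ds²_Ω`. -/
theorem layerMetric_layerGradient (p N : S → E3) (f : S × ℝ → ℝ) (z : S × ℝ)
    (hz : Function.Injective (layerDeriv p N z)) (X : E2 × ℝ) :
    layerMetric p N z (layerGradient p N f z) X = differential f z X := by
  have hd : Module.finrank ℝ (E2 × ℝ) = Module.finrank ℝ E3 := by simp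
  let e : (E2 × ℝ) ≃L[ℝ] E3 := (LinearEquiv.ofInjectiveOfFinrankEq
    (layerDeriv p N z : E2 × ℝ →ₗ[ℝ] E3) hz hd).toContinuousLinearEquiv
  have he : layerDeriv p N z = (e : E2 × ℝ →L[ℝ] E3) := by
    ext1 <;> ext1 <;> rfl
  simp only [layerMetric, layerGradient, he, ContinuousLinearMap.inverse_equiv]
  simp

/-- The Riemannian gradient, carried to `ℝ³` by the isometry `dp̃` of tangent spaces; thus
`⟪gradientVector f, gradientVector g⟫ = ds²_Ω (∇f, ∇g)`. -/
def gradientVector (p N : S → E3) (f : S × ℝ → ℝ) (z : S × ℝ) : E3 :=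
  layerDeriv p N z (layerGradient p N f z)

/-- `f ∈ C₀^∞(Ω)`: smooth, with compact support in the interior of the layer. -/
structure IsTestFunction (a : ℝ) (f : S × ℝ → ℝ) : Prop where
  contMDiff : ContMDiff ((𝓡 2).prod 𝓘(ℝ, ℝ)) 𝓘(ℝ, ℝ) ∞ f
  hasCompactSupport : HasCompactSupport f
  tsupport_subset : tsupport f ⊆ openLayer S a

/-! ### Volume, Dirichlet Laplacian and the bottom of its essential spectrum -/

variable [MeasurableSpace S]

/-- The Riemannian volume `dΩ`. As `p̃` is an isometric embedding, the volume of a set is the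
Lebesgue measure of its image under `p̃`; the boundary of the layer, a null set, is left out. -/
def layerVolume (p N : S → E3) (a : ℝ) : Measure (S × ℝ) :=
  ((volume : Measure E3).comap ((openLayer S a).domRestrict (layerMap p N))).map Subtype.val

/-- `L²(Ω, dΩ)`. -/
abbrev L2 (p N : S → E3) (a : ℝ) : Type _ := Lp ℝ 2 (layerVolume p N a)

/-- Square-integrable vector fields, carried to `ℝ³` by `dp̃`. -/
abbrev L2Vec (p N : S → E3) (a : ℝ) : Type _ := Lp E3 2 (layerVolume p N a)

/-- The pairs `(f, ∇f)` with `f ∈ C₀^∞(Ω)`, as elements of `L²`. -/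
def testPairs (p N : S → E3) (a : ℝ) : Set (L2 p N a × L2Vec p N a) :=
  {q | ∃ f, IsTestFunction a f ∧ q.1 =ᵐ[layerVolume p N a] f ∧
    q.2 =ᵐ[layerVolume p N a] gradientVector p N f}

/-- The Sobolev space `H¹₀(Ω)`, as the space of the pairs `(u, ∇u)`: the closure of `C₀^∞(Ω)`
in the norm `(‖u‖² + ‖∇u‖²)^(1/2)`. -/
def sobolevZero (p N : S → E3) (a : ℝ) : Submodule ℝ (L2 p N a × L2Vec p N a) :=
  (Submodule.span ℝ (testPairs p N a)).topologicalClosure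

/-- The (positive) Dirichlet Laplacian of the layer, by its graph. It is the self-adjoint operator
of the closed quadratic form `∫ |∇u|² dΩ` on `H¹₀(Ω)`, that is, the Friedrichs extension of the
Laplacian on `C₀^∞(Ω)`: `Δ u = w` if `u ∈ H¹₀(Ω)` and `∫ ⟨∇u, ∇f⟩ dΩ = ∫ w f dΩ` for all
`f ∈ C₀^∞(Ω)`. -/
def dirichletLaplacian (p N : S → E3) (a : ℝ) : Submodule ℝ (L2 p N a × L2 p N a) where
  carrier := {q | ∃ v : L2Vec p N a, (q.1, v) ∈ sobolevZero p N a ∧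
    ∀ g ∈ testPairs p N a, ⟪v, g.2⟫ = ⟪q.2, g.1⟫}
  add_mem' := by
    rintro q r ⟨v, hv, hv'⟩ ⟨w, hw, hw'⟩
    refine ⟨v + w, (sobolevZero p N a).add_mem hv hw, fun g hg => ?_⟩
    rw [inner_add_left, hv' g hg, hw' g hg, Prod.snd_add, inner_add_left]
  zero_mem' := ⟨0, (sobolevZero p N a).zero_mem, fun g _ => by simp⟩
  smul_mem' := by
    rintro c q ⟨v, hv, hv'⟩
    refine ⟨c • v, (sobolevZero p N a).smul_mem c hv, fun g hg => ?_⟩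
    rw [real_inner_smul_left, hv' g hg, Prod.smul_snd, real_inner_smul_left]

/-- The quotient `∫ |∇f|² dΩ / ∫ f² dΩ`. -/
def rayleighQuotient (p N : S → E3) (a : ℝ) (f : S × ℝ → ℝ) : ℝ :=
  (∫ z, layerMetric p N z (layerGradient p N f z) (layerGradient p N f z) ∂(layerVolume p N a)) /
    ∫ z, f z ^ 2 ∂(layerVolume p N a)

/-- The variational quantity `sup_K inf_f ∫ |∇f|² dΩ / ∫ f² dΩ`, over the compact subsets `K` of
`Ω` and the nonzero `f ∈ C₀^∞(Ω \ K)` (an infimum over no `f` is `⊤`). -/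
def variationalSigmaEss (p N : S → E3) (a : ℝ) : EReal :=
  ⨆ K : {K : Set (S × ℝ) // IsCompact K ∧ K ⊆ layer S a},
    ⨅ f : {f : S × ℝ → ℝ // IsTestFunction a f ∧ Disjoint (tsupport f) K.1 ∧ f ≠ 0},
      (rayleighQuotient p N a f.1 : EReal)

end Geometry

end QuantumLayer

end

/-!
The proof rests on one localized inequality. In Fermi coordinates `(x, t)` of the layer, let `N` be
the unit normal, extended to be independent of `t`, and let `X = τ(t) N` with `τ(t) = β tan (β t)`
and `β < π / (2 a)`; this is `-∇φ / φ` for the transversal profile `φ = cos (β t)`. Completing the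
square in `∫ |∇F + F X|² ≥ 0` and integrating by parts (`integral_sq_mul_divergence_le`) gives
`∫ |∇F|² ≥ ∫ F² (div X - |X|²)`, and `div X - |X|² = β² + τ(t) div N`. The divergence of `N` is
controlled by the second fundamental form, so it is small outside a compact set, and it is bounded
on compact sets because `p̃` is an immersion up to the boundary. Hence, for every
`c < π² / (4 a²)`, `∫ |∇F|² ≥ c ∫ F² - M ∫_K F²` for some compact `K`
(`exists_dirichlet_lower_bound`). Here test functions on the layer are moved to `ℝ³` by `p̃`, which
is isometric and, by the definition of `layerVolume`, volume preserving.

For `f` supported off `K` the last term vanishes, which is the variational statement.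

For the spectral statement, `∫_K F²` is at most `ε ∫ |∇F|²` plus finitely many squares of averages
of `F` over small cubes (`exists_cubes_setIntegral_sq_le`). So the form is bounded below by `c` on
a subspace of finite codimension (`exists_form_bound`). The rest is abstract: `(u, w)` lies in the
graph of the operator iff `u = B (w + u)`, with `B` positive and bounded (`exists_resolvent`),
so `1 - (d + 1) B` is not invertible for `d` in the spectrum. For `d < c` this
operator is bounded below on a subspace of finite codimension, which forces `d` to be an isolated
eigenvalue of finite multiplicity (`mem_discreteSpectrum_of_form_bound`).
-/

noncomputable section

namespace QuantumLayer

/-! ### Discrete spectrum below a form bound on a subspace of finite codimension -/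

section FunctionalAnalysis

variable {H : Type*} [NormedAddCommGroup H] [InnerProductSpace ℝ H] [CompleteSpace H]

/-- A symmetric bounded operator that is injective and bounded below on a closed subspace of finite
codimension is invertible: its range is closed, being the sum of a closed and a finite-dimensional
subspace, and its orthogonal complement is the kernel. -/
theorem isUnit_of_symmetric_of_bounded_below_orthogonal (T : H →L[ℝ] H)
    (hT : ∀ x y, ⟪T x, y⟫ = ⟪x, T y⟫) (F : Submodule ℝ H) [FiniteDimensional ℝ F] {δ : ℝ}
    (hδ : 0 < δ) (hF : ∀ x ∈ Fᗮ, δ * ‖x‖ ≤ ‖T x‖) (hker : ∀ x, T x = 0 → x = 0) : IsUnit T := by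
  have hcl : IsClosed ((Fᗮ.map (T : H →ₗ[ℝ] H) : Submodule ℝ H) : Set H) := by
    have h1 : AntilipschitzWith (Real.toNNReal δ⁻¹) (T.comp Fᗮ.subtypeL) := by
      refine AddMonoidHomClass.antilipschitz_of_bound _ fun x => ?_
      have := hF x x.2
      rw [Real.coe_toNNReal _ (by positivity), inv_mul_eq_div, le_div_iff₀ hδ, mul_comm]
      exact this
    have h2 := h1.isClosed_range (T.comp Fᗮ.subtypeL).uniformContinuous
    convert h2 using 1
    ext y; simp
  have hcl2 : IsClosed ((T : H →ₗ[ℝ] H).range : Set H) := by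
    have : (T : H →ₗ[ℝ] H).range = Fᗮ.map (T : H →ₗ[ℝ] H) ⊔ F.map (T : H →ₗ[ℝ] H) := by
      rw [← Submodule.map_sup, sup_comm,
        Submodule.sup_orthogonal_of_hasOrthogonalProjection, LinearMap.range_eq_map]
    rw [this]
    exact Submodule.isClosed_sup_finiteDimensional _ _ hcl
  have hrange : (T : H →ₗ[ℝ] H).range = ⊤ := by
    have : ((T : H →ₗ[ℝ] H).range)ᗮ = ⊥ := by
      rw [eq_bot_iff]
      intro y hy
      refine hker y (ext_inner_left ℝ fun x => ?_)
      rw [← hT, inner_zero_right]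
      exact hy _ ⟨x, rfl⟩
    rw [← Submodule.topologicalClosure_eq_top_iff] at this
    rwa [← hcl2.submodule_topologicalClosure_eq]
  rw [ContinuousLinearMap.isUnit_iff_bijective]
  refine ⟨?_, ?_⟩
  · rw [injective_iff_map_eq_zero]; exact hker
  · exact LinearMap.range_eq_top.mp hrange

omit [CompleteSpace H] in
theorem finiteDimensional_ker_of_bounded_below_orthogonal (T : H →L[ℝ] H)
    (F : Submodule ℝ H) [FiniteDimensional ℝ F] {δ : ℝ}
    (hδ : 0 < δ) (hF : ∀ x ∈ Fᗮ, δ * ‖x‖ ≤ ‖T x‖) :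
    FiniteDimensional ℝ (T : H →ₗ[ℝ] H).ker := by
  refine FiniteDimensional.of_injective
    ((F.orthogonalProjectionOnto : H →ₗ[ℝ] F).comp (T : H →ₗ[ℝ] H).ker.subtype) ?_
  rw [injective_iff_map_eq_zero]
  intro x hx
  have h1 : (x : H) ∈ Fᗮ := by
    rw [← Submodule.orthogonalProjectionOnto_eq_zero_iff]; exact hx
  have h2 := hF x h1
  have h3 : T (x : H) = 0 := x.2
  rw [h3, norm_zero] at h2
  have : ‖(x : H)‖ = 0 := le_antisymm (by nlinarith [norm_nonneg (x : H)]) (norm_nonneg _)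
  exact Subtype.ext (norm_eq_zero.mp this)

variable {H' : Type*} [NormedAddCommGroup H'] [InnerProductSpace ℝ H'] [CompleteSpace H']

/-- The resolvent at `-1` of the operator of a closed form: if `V` is the closed space of the pairs
`(u, ∇u)`, then the weak equation `(u, v) ∈ V`, `⟪v, g.2⟫ = ⟪w, g.1⟫` for `g ∈ V` says
`u = B (w + u)`, where `B = J J*` for the projection `J (u, v) = u` of the Hilbert space `V`.
Neither density of the domain nor closability of the form is needed: a kernel of `B` would only
make the operator multivalued. -/
theorem exists_resolvent (V : Submodule ℝ (H × H')) (hV : IsClosed (V : Set (H × H'))) :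
    ∃ B : H →L[ℝ] H, (∀ x y, ⟪B x, y⟫ = ⟪x, B y⟫) ∧
      (∀ x, ∃ v, (B x, v) ∈ V ∧ ⟪B x, x⟫ = ‖B x‖ ^ 2 + ‖v‖ ^ 2) ∧
      ∀ u w : H, u = B (w + u) ↔ ∃ v, (u, v) ∈ V ∧ ∀ g ∈ V, ⟪v, g.2⟫ = ⟪w, g.1⟫ := by
  let e := WithLp.prodContinuousLinearEquiv 2 ℝ H H'
  let W : Submodule ℝ (WithLp 2 (H × H')) := V.comap (e : WithLp 2 (H × H') →ₗ[ℝ] H × H')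
  have hW : IsClosed (W : Set (WithLp 2 (H × H'))) := hV.preimage e.continuous
  have : CompleteSpace W := hW.completeSpace_coe
  let J : W →L[ℝ] H := (ContinuousLinearMap.fst ℝ H H').comp
    ((e : WithLp 2 (H × H') →L[ℝ] H × H').comp W.subtypeL)
  refine ⟨J.comp J.adjoint, fun x y => ?_, fun x => ⟨(J.adjoint x : WithLp 2 (H × H')).snd, ?_, ?_⟩,
    fun u w => ⟨fun h => ⟨(J.adjoint (w + u) : WithLp 2 (H × H')).snd, ?_, fun g hg => ?_⟩, ?_⟩⟩
  · simp only [ContinuousLinearMap.comp_apply]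
    rw [← ContinuousLinearMap.adjoint_inner_right, ContinuousLinearMap.adjoint_inner_left]
  · exact (J.adjoint x).2
  · simp only [ContinuousLinearMap.comp_apply]
    rw [← ContinuousLinearMap.adjoint_inner_right, Submodule.coe_inner, WithLp.prod_inner_apply]
    simp only [real_inner_self_eq_norm_sq]
    rfl
  · have : (u, (J.adjoint (w + u) : WithLp 2 (H × H')).snd) = e (J.adjoint (w + u)) :=
      Prod.ext h rfl
    rw [this]
    exact (J.adjoint (w + u)).2
  · have h1 := ContinuousLinearMap.adjoint_inner_left J ⟨e.symm g, by simpa [W] using hg⟩ (w + u)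
    rw [Submodule.coe_inner, WithLp.prod_inner_apply] at h1
    have h2 : (J.adjoint (w + u) : WithLp 2 (H × H')).fst = u := h.symm
    have h3 : ⟪(J.adjoint (w + u) : WithLp 2 (H × H')).fst, g.1⟫ +
      ⟪(J.adjoint (w + u) : WithLp 2 (H × H')).snd, g.2⟫ = ⟪w + u, g.1⟫ := h1
    rw [h2, inner_add_left] at h3
    linarith
  · rintro ⟨v, hv, h⟩
    have h1 : J.adjoint (w + u) = ⟨e.symm (u, v), by simpa [W] using hv⟩ := by
      refine ext_inner_right ℝ fun q => ?_
      rw [ContinuousLinearMap.adjoint_inner_left, Submodule.coe_inner, WithLp.prod_inner_apply]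
      have h2 := h (e q) q.2
      change ⟪w + u, (q : WithLp 2 (H × H')).fst⟫ = ⟪u, (q : WithLp 2 (H × H')).fst⟫ +
        ⟪v, (q : WithLp 2 (H × H')).snd⟫
      change ⟪v, (q : WithLp 2 (H × H')).snd⟫ = ⟪w, (q : WithLp 2 (H × H')).fst⟫ at h2
      rw [h2, inner_add_left, add_comm]
    rw [ContinuousLinearMap.comp_apply, h1]
    rfl

/-- A closed form bounded below by `c₁ > c` on a subspace of finite codimension has only discrete
spectrum at `c`. -/
theorem mem_discreteSpectrum_of_form_bound (V : Submodule ℝ (H × H'))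
    (hV : IsClosed (V : Set (H × H'))) (A : Submodule ℝ (H × H))
    (hA : ∀ u w, (u, w) ∈ A ↔ ∃ v, (u, v) ∈ V ∧ ∀ g ∈ V, ⟪v, g.2⟫ = ⟪w, g.1⟫)
    (E : Submodule ℝ H) [FiniteDimensional ℝ E] {c c₁ : ℝ} (hc : c < c₁) (hc₁ : 0 < c₁)
    (hE : ∀ q ∈ V, q.1 ∈ Eᗮ → c₁ * ‖q.1‖ ^ 2 ≤ ‖q.2‖ ^ 2)
    (hspec : c ∈ spectrum A) : c ∈ discreteSpectrum A := by
  obtain ⟨B, hB, hBV, hBA⟩ := exists_resolvent V hV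
  have hA' : ∀ u w, (u, w) ∈ A ↔ u = B (w + u) := fun u w => by rw [hA, hBA]
  let T : ℝ → H →L[ℝ] H := fun d => 1 - (d + 1) • B
  have hT : ∀ d x, T d x = x - (d + 1) • B x := fun d x => rfl
  have hTsym : ∀ d x y, ⟪T d x, y⟫ = ⟪x, T d y⟫ := fun d x y => by
    simp only [hT, inner_sub_left, inner_sub_right, real_inner_smul_left, real_inner_smul_right, hB]
  have hres : ∀ d, IsUnit (T d) → d ∈ resolventSet A := by
    intro d hd
    obtain ⟨R, hR⟩ := hd
    refine ⟨(↑R⁻¹ : H →L[ℝ] H).comp B, fun u f => ?_⟩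
    have h1 : ∀ x, (↑R⁻¹ : H →L[ℝ] H) (T d x) = x := fun x => by
      rw [← hR]; exact congrArg (fun S : H →L[ℝ] H => S x) R.inv_mul
    have h2 : ∀ x, T d ((↑R⁻¹ : H →L[ℝ] H) x) = x := fun x => by
      rw [← hR]; exact congrArg (fun S : H →L[ℝ] H => S x) R.mul_inv
    have h3 : u = B (f + d • u + u) ↔ T d u = B f := by
      rw [hT, sub_eq_iff_eq_add, map_add, map_add, map_smul, add_smul, one_smul, add_assoc]
    rw [hA', h3, ContinuousLinearMap.comp_apply]
    constructor
    · intro h; rw [← h, h1]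
    · intro h; rw [h, h2]
  -- The form bound on `Eᗮ` becomes `⟪B x, x⟫ ≤ ‖x‖² / (1 + c₁)` on the complement of `F = B E`.
  let F : Submodule ℝ H := E.map (B : H →ₗ[ℝ] H)
  have hBF : ∀ x ∈ Fᗮ, (1 + c₁) * ⟪B x, x⟫ ≤ ‖x‖ ^ 2 := by
    intro x hx
    obtain ⟨v, hv, hx2⟩ := hBV x
    have h1 : B x ∈ Eᗮ := fun y hy => by rw [← hB]; exact hx _ ⟨y, hy, rfl⟩
    have h2 := hE _ hv h1
    simp only at h2
    have h3 : (1 + c₁) * ‖B x‖ ^ 2 ≤ ⟪B x, x⟫ := by linarith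
    have h4 := real_inner_le_norm (B x) x
    have h5 : (1 + c₁) * ‖B x‖ ≤ ‖x‖ := by
      rcases (norm_nonneg (B x)).eq_or_lt with h | h
      · rw [← h]; simp
      · refine le_of_mul_le_mul_right ?_ h
        nlinarith
    nlinarith [norm_nonneg x]
  have hTF : ∀ d < c₁, ∃ δ > 0, ∀ x ∈ Fᗮ, δ * ‖x‖ ≤ ‖T d x‖ := by
    intro d hd
    have h1 : ∃ δ > 0, ∀ x ∈ Fᗮ, δ * ‖x‖ ^ 2 ≤ ⟪T d x, x⟫ := by
      have h0 : ∀ x, ⟪T d x, x⟫ = ‖x‖ ^ 2 - (d + 1) * ⟪B x, x⟫ := fun x => by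
        rw [hT, inner_sub_left, real_inner_smul_left, real_inner_self_eq_norm_sq]
      have hpos : ∀ x, 0 ≤ ⟪B x, x⟫ := fun x => by
        obtain ⟨v, -, h⟩ := hBV x
        rw [h]; positivity
      rcases le_total (d + 1) 0 with h | h
      · refine ⟨1, one_pos, fun x _ => ?_⟩
        rw [h0]
        nlinarith [hpos x]
      · refine ⟨(c₁ - d) / (1 + c₁), div_pos (by linarith) (by linarith), fun x hx => ?_⟩
        have h2 := hBF x hx
        rw [h0, div_mul_eq_mul_div, div_le_iff₀ (by linarith)]
        nlinarith
    obtain ⟨δ, hδ, h⟩ := h1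
    refine ⟨δ, hδ, fun x hx => ?_⟩
    have h2 := (h x hx).trans (real_inner_le_norm _ _)
    rcases (norm_nonneg x).eq_or_lt with h3 | h3
    · rw [← h3]; simp
    · refine le_of_mul_le_mul_right ?_ h3
      nlinarith
  have hinj : ∀ d < c₁, (∀ x, T d x = 0 → x = 0) → d ∉ spectrum A := fun d hd h hd' => by
    obtain ⟨δ, hδ, hδ'⟩ := hTF d hd
    exact hd' (hres d
      (isUnit_of_symmetric_of_bounded_below_orthogonal (T d) (hTsym d) F hδ hδ' h))
  obtain ⟨δ, hδ, hδ'⟩ := hTF c hc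
  have hN : eigenspace A c = (T c : H →ₗ[ℝ] H).ker := by
    ext u
    have : u ∈ eigenspace A c ↔ (u, c • u) ∈ A := Iff.rfl
    rw [this, hA', LinearMap.mem_ker, ContinuousLinearMap.coe_coe, hT, sub_eq_zero, map_add,
      map_smul, add_smul, one_smul]
  have hfin : FiniteDimensional ℝ (T c : H →ₗ[ℝ] H).ker :=
    finiteDimensional_ker_of_bounded_below_orthogonal (T c) F hδ hδ'
  refine ⟨hspec, ?_, ?_, by rw [hN]; exact hfin⟩
  · -- `T c + P`, with `P` the projection onto the kernel of `T c`, is invertible, and so is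
    -- `T d + P` for `d` near `c`; for `d ≠ c` the kernel of `T d` is orthogonal to that of `T c`.
    let K := (T c : H →ₗ[ℝ] H).ker
    let P : H →L[ℝ] H := K.subtypeL.comp K.orthogonalProjectionOnto
    have hPK : ∀ x, P x ∈ K := fun x => (K.orthogonalProjectionOnto x).2
    have hPz : ∀ x ∈ Kᗮ, P x = 0 := fun x hx => by
      have h1 : K.orthogonalProjectionOnto x = 0 :=
        Submodule.orthogonalProjectionOnto_eq_zero_iff.mpr hx
      simp [P, h1]
    have hPid : ∀ x ∈ K, P x = x := fun x hx =>
      Submodule.starProjection_eq_self_iff.mpr hx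
    have hPsym : ∀ x y, ⟪P x, y⟫ = ⟪x, P y⟫ := fun x y =>
      Submodule.inner_starProjection_left_eq_right K x y
    have hunit : IsUnit (T c + P) := by
      refine isUnit_of_symmetric_of_bounded_below_orthogonal (T c + P) (fun x y => ?_) (F ⊔ K) hδ
        (fun x hx => ?_) (fun x hx => ?_)
      · simp only [add_apply, inner_add_left, inner_add_right, hTsym, hPsym]
      · rw [← Submodule.inf_orthogonal] at hx
        rw [add_apply, hPz x hx.2, add_zero]
        exact hδ' x hx.1
      · rw [add_apply] at hx
        have h1 : ⟪T c x, P x⟫ = 0 := by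
          rw [hTsym, show T c (P x) = 0 from hPK x, inner_zero_right]
        have h2 : P x = 0 := by
          have h3 : ⟪T c x + P x, P x⟫ = 0 := by rw [hx, inner_zero_left]
          rw [inner_add_left, h1, zero_add] at h3
          exact inner_self_eq_zero.mp h3
        rw [h2, add_zero] at hx
        rw [← h2]
        exact (hPid x hx).symm
    have hev : ∀ᶠ d in 𝓝 c, IsUnit (T d + P) := by
      have hcont : Continuous fun d => T d + P := by fun_prop
      exact hcont.continuousAt.eventually (Units.isOpen.mem_nhds hunit)
    intro hacc
    rw [accPt_iff_frequently_nhdsNE] at hacc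
    refine hacc ?_
    have hev' := (hev.and (eventually_lt_nhds hc)).filter_mono
      (nhdsWithin_le_nhds (s := {c}ᶜ))
    filter_upwards [hev', self_mem_nhdsWithin] with d hd hdc
    refine hinj d hd.2 fun x hx => ?_
    have hx0 : x ∈ Kᗮ := by
      intro y hy
      have hy' : T c y = 0 := hy
      rw [hT, sub_eq_zero] at hy' hx
      have h1 : ⟪y, x⟫ = (c + 1) * ⟪y, B x⟫ := by
        rw [← hB, ← real_inner_smul_left, ← hy']
      have h2 : ⟪y, x⟫ = (d + 1) * ⟪y, B x⟫ := by
        rw [← real_inner_smul_right, ← hx]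
      have h3 : (d - c) * ⟪y, B x⟫ = 0 := by linarith
      rcases mul_eq_zero.mp h3 with h | h
      · exact absurd (sub_eq_zero.mp h) hdc
      · rw [h1, h, mul_zero]
    have h1 : (T d + P) x = 0 := by rw [add_apply, hx, hPz x hx0, add_zero]
    rw [ContinuousLinearMap.isUnit_iff_bijective] at hd
    exact hd.1.1 (by rw [h1, map_zero])
  · intro hbot
    rw [hN] at hbot
    refine hinj c hc (fun x hx => ?_) hspec
    have : x ∈ (T c : H →ₗ[ℝ] H).ker := hx
    rw [hbot] at this
    exact this

end FunctionalAnalysis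

/-! ### Averages over cubes and the Dirichlet integral -/

section Poincare

variable {E : Type*} [NormedAddCommGroup E] [NormedSpace ℝ E]

theorem sq_sub_le_integral_sq_fderiv {F : E → ℝ} (hF : ContDiff ℝ 1 F) (x h : E) :
    (F (x + h) - F x) ^ 2 ≤ ‖h‖ ^ 2 * ∫ s in (0 : ℝ)..1, ‖fderiv ℝ F (x + s • h)‖ ^ 2 := by
  have hF' : Continuous (fderiv ℝ F) := hF.continuous_fderiv one_ne_zero
  have h1 : ∫ s in (0 : ℝ)..1, fderiv ℝ F (x + s • h) h = F (x + h) - F x := by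
    rw [intervalIntegral.integral_eq_sub_of_hasDerivAt (f := fun s : ℝ => F (x + s • h))]
    · simp
    · intro s _
      have h2 : HasDerivAt (fun s : ℝ => x + s • h) h s := by
        simpa using ((hasDerivAt_id s).smul_const h).const_add x
      exact ((hF.differentiable one_ne_zero) _).hasFDerivAt.comp_hasDerivAt s h2
    · exact Continuous.intervalIntegrable (by fun_prop) _ _
  set Δ := F (x + h) - F x
  have h2 : ∫ s in (0 : ℝ)..1, (2 * Δ * fderiv ℝ F (x + s • h) h - Δ ^ 2) = Δ ^ 2 := by
    rw [intervalIntegral.integral_sub (Continuous.intervalIntegrable (by fun_prop) _ _)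
      (Continuous.intervalIntegrable (by fun_prop) _ _), intervalIntegral.integral_const_mul, h1]
    simp; ring
  -- Jensen's inequality `(∫ g)² ≤ ∫ g²` in the form `∫ (2 Δ g - Δ²) ≤ ∫ g²` with `Δ = ∫ g`.
  rw [← h2, ← intervalIntegral.integral_const_mul]
  refine intervalIntegral.integral_mono zero_le_one
    (Continuous.intervalIntegrable (by fun_prop) _ _)
    (Continuous.intervalIntegrable (by fun_prop) _ _) fun s => ?_
  have h3 : |fderiv ℝ F (x + s • h) h| ≤ ‖fderiv ℝ F (x + s • h)‖ * ‖h‖ :=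
    (fderiv ℝ F (x + s • h)).le_opNorm h
  have h4 : (fderiv ℝ F (x + s • h) h) ^ 2 ≤ ‖h‖ ^ 2 * ‖fderiv ℝ F (x + s • h)‖ ^ 2 := by
    rw [← sq_abs, ← mul_pow, mul_comm ‖h‖]
    gcongr
  nlinarith [sq_nonneg (fderiv ℝ F (x + s • h) h - Δ)]

variable [MeasurableSpace E] [BorelSpace E] [FiniteDimensional ℝ E]
  (μ : Measure E) [μ.IsAddHaarMeasure]

/-- The `L²` modulus of continuity under translations is controlled by the gradient. -/
theorem lintegral_sq_translate_sub_le {F : E → ℝ} (hF : ContDiff ℝ 1 F) (h : E) :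
    ∫⁻ x, ENNReal.ofReal ((F (x + h) - F x) ^ 2) ∂μ ≤
      ENNReal.ofReal (‖h‖ ^ 2) * ∫⁻ x, ENNReal.ofReal (‖fderiv ℝ F x‖ ^ 2) ∂μ := by
  have hF' : Continuous (fderiv ℝ F) := hF.continuous_fderiv one_ne_zero
  have h1 : ∀ x, ENNReal.ofReal ((F (x + h) - F x) ^ 2) ≤ ENNReal.ofReal (‖h‖ ^ 2) *
      ∫⁻ s in Ioc (0 : ℝ) 1, ENNReal.ofReal (‖fderiv ℝ F (x + s • h)‖ ^ 2) := fun x => by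
    rw [← ofReal_integral_eq_lintegral_ofReal, ← ENNReal.ofReal_mul (by positivity),
      ← intervalIntegral.integral_of_le zero_le_one]
    · exact ENNReal.ofReal_le_ofReal (sq_sub_le_integral_sq_fderiv hF x h)
    · exact Continuous.integrableOn_Ioc (by fun_prop)
    · exact Eventually.of_forall fun s => by positivity
  refine (lintegral_mono h1).trans ?_
  rw [lintegral_const_mul' _ _ ENNReal.ofReal_ne_top, lintegral_lintegral_swap]
  · gcongr
    refine (lintegral_mono fun s => (lintegral_add_right_eq_self
      (fun x => ENNReal.ofReal (‖fderiv ℝ F x‖ ^ 2)) (s • h)).le).trans ?_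
    simp
  · refine Continuous.aemeasurable ?_
    have : Continuous fun q : E × ℝ => fderiv ℝ F (q.1 + q.2 • h) := by fun_prop
    exact ENNReal.continuous_ofReal.comp (this.norm.pow 2)

/-- A Poincaré inequality for families of disjoint cells of equal volume `m`, whose difference sets
lie in `B`: the variances on the cells are controlled by translations with vectors of `B`. -/
theorem sum_setIntegral_sq_le {F : E → ℝ} (hF : ContDiff ℝ 1 F) (hFc : HasCompactSupport F)
    {ι : Type*} (s : Finset ι) (Q : ι → Set E) (hQm : ∀ i, MeasurableSet (Q i))
    (hQd : Pairwise (Function.onFun Disjoint Q)) {m b d : ℝ} (hm : 0 < m)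
    (hQ : ∀ i, μ (Q i) = ENNReal.ofReal m) {B : Set E} (hB : MeasurableSet B) (hb : 0 ≤ b)
    (hBm : μ B = ENNReal.ofReal b) (hBd : ∀ h ∈ B, ‖h‖ ≤ d)
    (hQB : ∀ i, ∀ x ∈ Q i, ∀ y ∈ Q i, y - x ∈ B) :
    ∑ i ∈ s, ∫ x in Q i, F x ^ 2 ∂μ ≤
      b * d ^ 2 / (2 * m) * ∫ x, ‖fderiv ℝ F x‖ ^ 2 ∂μ +
        m⁻¹ * ∑ i ∈ s, (∫ x in Q i, F x ∂μ) ^ 2 := by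
  have hFcont := hF.continuous
  have hF' : Continuous (fderiv ℝ F) := hF.continuous_fderiv one_ne_zero
  have hFi : Integrable F μ := hFcont.integrable_of_hasCompactSupport hFc
  have hFi2 : Integrable (fun x => F x ^ 2) μ :=
    Continuous.integrable_of_hasCompactSupport (by fun_prop)
      (hFc.comp_left (g := fun t : ℝ => t ^ 2) (by simp))
  have hDi : Integrable (fun x => ‖fderiv ℝ F x‖ ^ 2) μ :=
    Continuous.integrable_of_hasCompactSupport (by fun_prop)
      ((hFc.fderiv ℝ).comp_left (g := fun t : E →L[ℝ] ℝ => ‖t‖ ^ 2) (by simp))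
  have hTc : Continuous fun q : E × E => ENNReal.ofReal ((F (q.1 + q.2) - F q.1) ^ 2) := by
    refine ENNReal.continuous_ofReal.comp ?_
    fun_prop
  -- The variance on a cell is a double integral of squared differences.
  have hcell : ∀ i, ENNReal.ofReal (2 * (m * ∫ x in Q i, F x ^ 2 ∂μ - (∫ x in Q i, F x ∂μ) ^ 2)) =
      ∫⁻ x in Q i, ∫⁻ y in Q i, ENNReal.ofReal ((F y - F x) ^ 2) ∂μ ∂μ := by
    intro i
    set a := ∫ x in Q i, F x ∂μ with ha
    set c := ∫ x in Q i, F x ^ 2 ∂μ with hc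
    have hfin : IsFiniteMeasure (μ.restrict (Q i)) := ⟨by simp [hQ]⟩
    have hreal : (μ.restrict (Q i)).real univ = m := by
      simp [Measure.real, hQ, hm.le]
    have h1 : ∀ x, Integrable (fun y => (F y - F x) ^ 2) (μ.restrict (Q i)) := fun x => by
      have : (fun y => (F y - F x) ^ 2) = fun y => F y ^ 2 - 2 * F x * F y + F x ^ 2 := by
        ext y; ring
      rw [this]
      exact ((hFi2.restrict).sub ((hFi.restrict).const_mul _)).add (integrable_const _)
    have h2 : ∀ x, ∫ y in Q i, (F y - F x) ^ 2 ∂μ = c - 2 * F x * a + m * F x ^ 2 := fun x => by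
      have : (fun y => (F y - F x) ^ 2) = fun y => F y ^ 2 - 2 * F x * F y + F x ^ 2 := by
        ext y; ring
      have hI : Integrable (fun y => F y ^ 2 - 2 * F x * F y) (μ.restrict (Q i)) :=
        (hFi2.restrict).sub ((hFi.restrict).const_mul _)
      rw [this, integral_add hI (integrable_const _),
        integral_sub hFi2.restrict ((hFi.restrict).const_mul _), integral_const_mul, integral_const,
        hreal, smul_eq_mul]
    have h3 : ∀ x, ∫⁻ y in Q i, ENNReal.ofReal ((F y - F x) ^ 2) ∂μ =
        ENNReal.ofReal (c - 2 * F x * a + m * F x ^ 2) := fun x => by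
      rw [← h2, ofReal_integral_eq_lintegral_ofReal (h1 x)
        (Eventually.of_forall fun y => by positivity)]
    have hI1 : Integrable (fun x => c - 2 * F x * a) (μ.restrict (Q i)) :=
      (integrable_const _).sub (((hFi.restrict).const_mul _).mul_const _)
    simp_rw [h3]
    rw [← ofReal_integral_eq_lintegral_ofReal]
    · congr 1
      rw [integral_add hI1 ((hFi2.restrict).const_mul _), integral_sub (integrable_const _)
        (((hFi.restrict).const_mul _).mul_const _), integral_const, hreal, integral_mul_const,
        integral_const_mul, integral_const_mul, ← ha, ← hc, smul_eq_mul]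
      ring
    · exact hI1.add ((hFi2.restrict).const_mul _)
    · refine Eventually.of_forall fun x => ?_
      simp only [Pi.zero_apply]
      rw [← h2]
      exact integral_nonneg fun y => by positivity
  have hshift : ∀ i, ∀ x ∈ Q i, ∫⁻ y in Q i, ENNReal.ofReal ((F y - F x) ^ 2) ∂μ ≤
      ∫⁻ h in B, ENNReal.ofReal ((F (x + h) - F x) ^ 2) ∂μ := by
    intro i x hx
    rw [← lintegral_indicator (hQm i), ← lintegral_indicator hB,
      ← lintegral_add_left_eq_self _ x]
    refine lintegral_mono fun h => ?_
    by_cases hh : x + h ∈ Q i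
    · have : h ∈ B := by simpa using hQB i x hx _ hh
      simp [hh, this]
    · simp [hh]
  have hsum : ∑ i ∈ s, ENNReal.ofReal (2 * (m * ∫ x in Q i, F x ^ 2 ∂μ - (∫ x in Q i, F x ∂μ) ^ 2))
      ≤ ENNReal.ofReal (b * d ^ 2 * ∫ x, ‖fderiv ℝ F x‖ ^ 2 ∂μ) := by
    calc _ ≤ ∑ i ∈ s, ∫⁻ x in Q i, ∫⁻ h in B, ENNReal.ofReal ((F (x + h) - F x) ^ 2) ∂μ ∂μ := by
          refine Finset.sum_le_sum fun i _ => ?_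
          rw [hcell]
          exact setLIntegral_mono' (hQm i) (hshift i)
      _ = ∫⁻ x in ⋃ i ∈ s, Q i, ∫⁻ h in B, ENNReal.ofReal ((F (x + h) - F x) ^ 2) ∂μ ∂μ := by
          rw [lintegral_biUnion_finset (fun i _ j _ hij => hQd hij) (fun i _ => hQm i)]
      _ ≤ ∫⁻ x, ∫⁻ h in B, ENNReal.ofReal ((F (x + h) - F x) ^ 2) ∂μ ∂μ :=
          setLIntegral_le_lintegral _ _
      _ = ∫⁻ h in B, ∫⁻ x, ENNReal.ofReal ((F (x + h) - F x) ^ 2) ∂μ ∂μ :=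
          lintegral_lintegral_swap hTc.aemeasurable
      _ ≤ ∫⁻ h in B, ENNReal.ofReal (d ^ 2) * ENNReal.ofReal (∫ x, ‖fderiv ℝ F x‖ ^ 2 ∂μ) ∂μ := by
          refine setLIntegral_mono' hB fun h hh => (lintegral_sq_translate_sub_le μ hF h).trans ?_
          rw [ofReal_integral_eq_lintegral_ofReal hDi (Eventually.of_forall fun y => by positivity)]
          gcongr
          exact hBd h hh
      _ = _ := by
          rw [lintegral_const, Measure.restrict_apply_univ, hBm, mul_comm,
            ← ENNReal.ofReal_mul (by positivity), ← ENNReal.ofReal_mul (by positivity), mul_assoc]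
  have hreal : ∑ i ∈ s, 2 * (m * ∫ x in Q i, F x ^ 2 ∂μ - (∫ x in Q i, F x ∂μ) ^ 2) ≤
      b * d ^ 2 * ∫ x, ‖fderiv ℝ F x‖ ^ 2 ∂μ := by
    rw [← ENNReal.ofReal_le_ofReal_iff
      (mul_nonneg (by positivity) (integral_nonneg fun x => by positivity))]
    refine le_trans ?_ hsum
    exact Finset.le_sum_of_subadditive _ ENNReal.ofReal_zero.le
      (fun _ _ => ENNReal.ofReal_add_le) s _
  have hexp : ∑ i ∈ s, 2 * (m * ∫ x in Q i, F x ^ 2 ∂μ - (∫ x in Q i, F x ∂μ) ^ 2) =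
      2 * m * ∑ i ∈ s, ∫ x in Q i, F x ^ 2 ∂μ - 2 * ∑ i ∈ s, (∫ x in Q i, F x ∂μ) ^ 2 := by
    simp only [Finset.mul_sum, ← Finset.sum_sub_distrib]
    exact Finset.sum_congr rfl fun i _ => by ring
  rw [hexp] at hreal
  rw [← sub_nonneg] at hreal ⊢
  have : 0 ≤ (2 * m)⁻¹ * (b * d ^ 2 * ∫ x, ‖fderiv ℝ F x‖ ^ 2 ∂μ -
      (2 * m * ∑ i ∈ s, ∫ x in Q i, F x ^ 2 ∂μ - 2 * ∑ i ∈ s, (∫ x in Q i, F x ∂μ) ^ 2)) :=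
    mul_nonneg (by positivity) hreal
  convert this using 1
  field_simp
  ring

end Poincare

section Cubes

/-- The half-open cube of side `n⁻¹` with corner `n⁻¹ • ν`. -/
def cube (n : ℝ) (ν : Fin 3 → ℤ) : Set E3 := {x | ∀ i, n * x i ∈ Ico (ν i : ℝ) (ν i + 1)}

theorem volume_euclidean_pi (I : Fin 3 → Set ℝ) (hI : ∀ i, MeasurableSet (I i)) :
    volume {x : E3 | ∀ i, x i ∈ I i} = ∏ i, volume (I i) := by
  have h1 : {x : E3 | ∀ i, x i ∈ I i} = WithLp.ofLp ⁻¹' (univ.pi I) := by ext; simp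
  rw [h1, (PiLp.volume_preserving_ofLp (Fin 3)).measure_preimage
    (MeasurableSet.univ_pi hI).nullMeasurableSet, volume_pi_pi]

theorem cube_eq {n : ℝ} (hn : 0 < n) (ν : Fin 3 → ℤ) :
    cube n ν = {x | ∀ i, x i ∈ Ico (ν i / n : ℝ) ((ν i + 1) / n)} := by
  ext x
  simp only [cube, mem_ofPred_eq, mem_Ico, div_le_iff₀ hn, lt_div_iff₀ hn, mul_comm]

theorem measurableSet_cube {n : ℝ} (ν : Fin 3 → ℤ) : MeasurableSet (cube n ν) := by
  have : cube n ν = ⋂ i, (fun x : E3 => n * x i) ⁻¹' Ico (ν i : ℝ) (ν i + 1) := by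
    ext; simp [cube]
  rw [this]
  refine MeasurableSet.iInter fun i => ?_
  have : Continuous fun x : E3 => n * x i := by fun_prop
  exact this.measurable measurableSet_Ico

theorem volume_cube {n : ℝ} (hn : 0 < n) (ν : Fin 3 → ℤ) :
    volume (cube n ν) = ENNReal.ofReal (n⁻¹ ^ 3) := by
  rw [cube_eq hn, volume_euclidean_pi _ fun i => measurableSet_Ico]
  have : ∀ i, ((ν i : ℝ) + 1) / n - ν i / n = n⁻¹ := fun i => by field_simp; ring
  simp only [Real.volume_Ico, this, Finset.prod_const, Finset.card_univ, Fintype.card_fin]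
  rw [ENNReal.ofReal_pow (inv_nonneg.mpr hn.le)]

theorem pairwise_disjoint_cube (n : ℝ) : Pairwise (Function.onFun Disjoint (cube n)) := by
  intro ν ν' h
  rw [Function.onFun, Set.disjoint_left]
  intro x hx hx'
  refine h (funext fun i => ?_)
  rw [← Int.floor_eq_on_Ico _ _ (hx i), ← Int.floor_eq_on_Ico _ _ (hx' i)]

/-- On a bounded set, the `L²` norm is controlled by finitely many averages up to an arbitrarily
small multiple of the Dirichlet integral; this quantifies Rellich's theorem. -/
theorem exists_cubes_setIntegral_sq_le {K : Set E3} (hK : Bornology.IsBounded K)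
    {ε : ℝ} (hε : 0 < ε) :
    ∃ (C n : ℝ) (s : Finset (Fin 3 → ℤ)), 0 < n ∧ ∀ F : E3 → ℝ, ContDiff ℝ 1 F →
      HasCompactSupport F → ∫ x in K, F x ^ 2 ≤
        ε * (∫ x, ‖fderiv ℝ F x‖ ^ 2) + C * ∑ ν ∈ s, (∫ x in cube n ν, F x) ^ 2 := by
  -- Cubes of side `n⁻¹` have the constant `12 / n² ≤ ε` in `sum_setIntegral_sq_le`.
  obtain ⟨n, hn1, hnε⟩ : ∃ n : ℝ, 1 ≤ n ∧ 12 / ε ≤ n :=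
    ⟨max 1 (12 / ε), le_max_left _ _, le_max_right _ _⟩
  have hn : 0 < n := by linarith
  obtain ⟨R, hR⟩ := hK.exists_norm_le
  obtain ⟨r, hr⟩ := exists_nat_ge (n * R)
  let s : Finset (Fin 3 → ℤ) := Fintype.piFinset fun _ => Finset.Icc (-(r : ℤ)) r
  have hcover : K ⊆ ⋃ ν ∈ s, cube n ν := by
    intro x hx
    have h1 : ∀ i, |n * x i| ≤ r := fun i => by
      rw [abs_mul, abs_of_pos hn]
      have := PiLp.norm_apply_le x i
      rw [Real.norm_eq_abs] at this
      exact (mul_le_mul_of_nonneg_left (this.trans (hR x hx)) hn.le).trans hr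
    refine mem_biUnion (x := fun i => ⌊n * x i⌋) ?_
      fun i => ⟨Int.floor_le _, Int.lt_floor_add_one _⟩
    simp only [s, Finset.mem_coe, Fintype.mem_piFinset, Finset.mem_Icc]
    intro i
    have h2 := abs_le.mp (h1 i)
    refine ⟨Int.le_floor.mpr (by push_cast; exact h2.1), ?_⟩
    exact_mod_cast (Int.floor_le (n * x i)).trans h2.2
  refine ⟨(n⁻¹ ^ 3)⁻¹, n, s, hn, fun F hF hFc => ?_⟩
  let B : Set E3 := {h | ∀ i, h i ∈ Ioo (-n⁻¹) n⁻¹}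
  have hBm : MeasurableSet B := by
    have : B = ⋂ i, (fun x : E3 => x i) ⁻¹' Ioo (-n⁻¹) n⁻¹ := by ext; simp [B]
    rw [this]
    refine MeasurableSet.iInter fun i => ?_
    have : Continuous fun x : E3 => x i := by fun_prop
    exact this.measurable measurableSet_Ioo
  have hBv : volume B = ENNReal.ofReal (8 * n⁻¹ ^ 3) := by
    rw [volume_euclidean_pi _ fun i => measurableSet_Ioo]
    simp only [Real.volume_Ioo, Finset.prod_const, Finset.card_univ, Fintype.card_fin]
    rw [← ENNReal.ofReal_pow (by rw [sub_neg_eq_add]; positivity)]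
    congr 1
    ring
  have hBd : ∀ h ∈ B, ‖h‖ ≤ √3 * n⁻¹ := fun h hh => by
    rw [EuclideanSpace.norm_eq]
    refine Real.sqrt_le_iff.mpr ⟨by positivity, ?_⟩
    rw [mul_pow, Real.sq_sqrt (by norm_num), Fin.sum_univ_three]
    have h1 : ∀ i, ‖h i‖ ^ 2 ≤ n⁻¹ ^ 2 := fun i => by
      have := hh i
      rw [Real.norm_eq_abs, sq_abs]
      exact sq_le_sq' this.1.le this.2.le
    linarith [h1 0, h1 1, h1 2]
  have hQB : ∀ ν, ∀ x ∈ cube n ν, ∀ y ∈ cube n ν, y - x ∈ B := by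
    intro ν x hx y hy i
    have h1 := hx i
    have h2 := hy i
    simp only [mem_Ico, mem_Ioo, PiLp.sub_apply] at *
    have h3 : n * n⁻¹ = 1 := mul_inv_cancel₀ hn.ne'
    constructor
    · refine lt_of_mul_lt_mul_left ?_ hn.le
      linarith
    · refine lt_of_mul_lt_mul_left ?_ hn.le
      linarith
  have hF2 : Integrable (fun x => F x ^ 2) (volume : Measure E3) :=
    Continuous.integrable_of_hasCompactSupport (hF.continuous.pow 2)
      (hFc.comp_left (g := fun t : ℝ => t ^ 2) (by simp))
  have h1 := sum_setIntegral_sq_le volume hF hFc s (cube n) measurableSet_cube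
    (pairwise_disjoint_cube n) (m := n⁻¹ ^ 3) (by positivity) (volume_cube hn) hBm
    (by positivity) hBv hBd hQB
  have h2 : ∫ x in K, F x ^ 2 ≤ ∑ ν ∈ s, ∫ x in cube n ν, F x ^ 2 := by
    rw [← integral_biUnion_finset s (fun ν _ => measurableSet_cube ν)
      (fun ν _ ν' _ h => pairwise_disjoint_cube n h) fun ν _ => hF2.integrableOn]
    exact setIntegral_mono_set hF2.integrableOn (Eventually.of_forall fun x => by positivity)
      hcover.eventuallyLE
  refine h2.trans (h1.trans ?_)
  have h3 : 8 * n⁻¹ ^ 3 * (√3 * n⁻¹) ^ 2 / (2 * n⁻¹ ^ 3) ≤ ε := by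
    have h4 : 8 * n⁻¹ ^ 3 * (√3 * n⁻¹) ^ 2 / (2 * n⁻¹ ^ 3) = 12 / n ^ 2 := by
      rw [mul_pow, Real.sq_sqrt (by norm_num)]
      field_simp
      norm_num
    rw [h4, div_le_iff₀ (by positivity)]
    rw [div_le_iff₀ hε] at hnε
    nlinarith
  exact add_le_add (mul_le_mul_of_nonneg_right h3 (integral_nonneg fun x => by positivity)) le_rfl

end Cubes

/-! ### Barta's inequality and local inverses -/

section Barta

theorem continuous_mul_of_continuousOn {Y : Type*} [TopologicalSpace Y] {F φ : Y → ℝ} {U : Set Y}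
    (hU : IsOpen U) (hF : Continuous F) (hFU : tsupport F ⊆ U) (hφ : ContinuousOn φ U) :
    Continuous fun y => F y * φ y := by
  refine continuous_iff_continuousAt.mpr fun y => ?_
  by_cases hy : y ∈ tsupport F
  · exact hF.continuousAt.mul (hφ.continuousAt (hU.mem_nhds (hFU hy)))
  · have : (fun y => F y * φ y) =ᶠ[𝓝 y] fun _ => 0 := by
      filter_upwards [(isClosed_tsupport F).isOpen_compl.mem_nhds hy] with z hz
      rw [image_eq_zero_of_notMem_tsupport hz, zero_mul]
    exact continuousAt_const.congr this.symm

theorem integrable_mul_of_continuousOn {F φ : E3 → ℝ} {U : Set E3} (hU : IsOpen U)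
    (hF : Continuous F) (hFc : HasCompactSupport F) (hFU : tsupport F ⊆ U)
    (hφ : ContinuousOn φ U) : Integrable fun y => F y * φ y :=
  (continuous_mul_of_continuousOn hU hF hFU hφ).integrable_of_hasCompactSupport hFc.mul_right

/-- The divergence of a vector field on `ℝ³`. -/
def divergence (X : E3 → E3) (y : E3) : ℝ := ∑ i, fderiv ℝ X y (EuclideanSpace.single i 1) i

theorem abs_sum_apply_single_le (T : E3 →L[ℝ] E3) :
    |∑ i, T (EuclideanSpace.single i 1) i| ≤ 3 * ‖T‖ := by
  refine (Finset.abs_sum_le_sum_abs _ _).trans ?_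
  have h : ∀ i : Fin 3, |T (EuclideanSpace.single i 1) i| ≤ ‖T‖ := fun i => by
    refine (PiLp.norm_apply_le (T (EuclideanSpace.single i 1)) i).trans ?_
    simpa using T.le_opNorm (EuclideanSpace.single i 1)
  refine (Finset.sum_le_sum fun i _ => h i).trans ?_
  simp

theorem sum_apply_smul_single (L : E3 →L[ℝ] ℝ) (v : E3) :
    ∑ i, L (EuclideanSpace.single i 1) * v i = L v := by
  have h : v = ∑ i, v i • (EuclideanSpace.single i 1 : E3) := by
    ext j
    simp [Finset.sum_apply, Pi.single_apply]
  conv_rhs => rw [h]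
  rw [map_sum]
  exact Finset.sum_congr rfl fun i _ => by rw [map_smul, smul_eq_mul, mul_comm]

theorem integrable_sq_mul_divergence_sub {U : Set E3} (hU : IsOpen U) {F : E3 → ℝ}
    (hFcont : Continuous F) (hFc : HasCompactSupport F) (hFU : tsupport F ⊆ U) {X : E3 → E3}
    (hX : ContDiffOn ℝ 1 X U) :
    Integrable fun y => F y ^ 2 * (divergence X y - ‖X y‖ ^ 2) := by
  have hX' : ContinuousOn (fderiv ℝ X) U := hX.continuousOn_fderiv_of_isOpen hU le_rfl
  have hdivc : ContinuousOn (fun y => divergence X y) U :=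
    continuousOn_finsetSum _ fun i _ =>
      (by fun_prop : Continuous fun T : E3 →L[ℝ] E3 =>
        T (EuclideanSpace.single i 1) i).comp_continuousOn hX'
  have : (fun y => F y ^ 2 * (divergence X y - ‖X y‖ ^ 2)) =
    fun y => F y * (F y * (divergence X y - ‖X y‖ ^ 2)) := by ext y; ring
  rw [this]
  exact integrable_mul_of_continuousOn hU hFcont hFc hFU
    (hFcont.continuousOn.mul (hdivc.sub (hX.continuousOn.norm.pow 2)))

/-- Barta's inequality in Hardy form: completing the square in `∫ ‖∇F + F X‖² ≥ 0` and integrating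
by parts gives a lower bound for the Dirichlet integral for any field `X` near the support. -/
theorem integral_sq_mul_divergence_le {U : Set E3} (hU : IsOpen U) {F : E3 → ℝ}
    (hF : ContDiff ℝ 1 F) (hFc : HasCompactSupport F) (hFU : tsupport F ⊆ U) {X : E3 → E3}
    (hX : ContDiffOn ℝ 1 X U) :
    ∫ y, F y ^ 2 * (divergence X y - ‖X y‖ ^ 2) ≤ ∫ y, ‖fderiv ℝ F y‖ ^ 2 := by
  have hFcont := hF.continuous
  have hF' : Continuous (fderiv ℝ F) := hF.continuous_fderiv one_ne_zero
  have hFd := hF.differentiable one_ne_zero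
  have hX' : ContinuousOn (fderiv ℝ X) U := hX.continuousOn_fderiv_of_isOpen hU le_rfl
  have hXd : ∀ y ∈ U, DifferentiableAt ℝ X y := fun y hy =>
    (hX.differentiableOn one_ne_zero).differentiableAt (hU.mem_nhds hy)
  have hXi : ∀ i, ContinuousOn (fun y => X y i) U := fun i =>
    (by fun_prop : Continuous fun v : E3 => v i).comp_continuousOn hX.continuousOn
  have hX'i : ∀ v i, ContinuousOn (fun y => fderiv ℝ X y v i) U := fun v i =>
    (by fun_prop : Continuous fun T : E3 →L[ℝ] E3 => T v i).comp_continuousOn hX'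
  have hg : ∀ i, ∀ y ∈ U, HasFDerivAt (fun y => F y * X y i)
      (F y • ((EuclideanSpace.proj i).comp (fderiv ℝ X y)) + X y i • fderiv ℝ F y) y := by
    intro i y hy
    have h1 : HasFDerivAt (fun y => X y i) ((EuclideanSpace.proj i).comp (fderiv ℝ X y)) y :=
      (EuclideanSpace.proj (𝕜 := ℝ) i).hasFDerivAt.comp y (hXd y hy).hasFDerivAt
    exact (hFd y).hasFDerivAt.mul h1
  have hFz : ∀ y ∉ U, F y = 0 := fun y hy => image_eq_zero_of_notMem_tsupport fun h => hy (hFU h)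
  have hparts : ∀ i : Fin 3,
      Integrable (fun y => F y * (F y * fderiv ℝ X y (EuclideanSpace.single i 1) i +
        2 * (fderiv ℝ F y (EuclideanSpace.single i 1) * X y i))) ∧
      ∫ y, F y * (F y * fderiv ℝ X y (EuclideanSpace.single i 1) i +
        2 * (fderiv ℝ F y (EuclideanSpace.single i 1) * X y i)) = 0 := by
    intro i
    set e : E3 := EuclideanSpace.single i 1
    have h1 : (fun y => F y * fderiv ℝ (fun y => F y * X y i) y e) =
        fun y => F y * (F y * fderiv ℝ X y e i + X y i * fderiv ℝ F y e) := by
      ext y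
      by_cases hy : y ∈ U
      · rw [(hg i y hy).fderiv]
        simp
      · rw [hFz y hy, zero_mul, zero_mul]
    have hi1 : Integrable fun y => F y * fderiv ℝ (fun y => F y * X y i) y e := by
      rw [h1]
      exact integrable_mul_of_continuousOn hU hFcont hFc hFU
        ((hFcont.continuousOn.mul (hX'i e i)).add
          ((hXi i).mul (by fun_prop : Continuous fun y => fderiv ℝ F y e).continuousOn))
    have h2 : (fun y => fderiv ℝ F y e * (F y * X y i)) =
        fun y => F y * (X y i * fderiv ℝ F y e) := by
      ext y; ring
    have hi2 : Integrable fun y => fderiv ℝ F y e * (F y * X y i) := by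
      rw [h2]
      exact integrable_mul_of_continuousOn hU hFcont hFc hFU
          ((hXi i).mul (by fun_prop : Continuous fun y => fderiv ℝ F y e).continuousOn)
    have h3 := integral_mul_fderiv_eq_neg_fderiv_mul_of_integrable
      (μ := (volume : Measure E3)) hi2 hi1
      (integrable_mul_of_continuousOn hU hFcont hFc hFU (hFcont.continuousOn.mul (hXi i)))
      (fun x _ => hFd x) (fun x hx => (hg i x (hFU hx)).differentiableAt)
    have h4 : (fun y => F y * (F y * fderiv ℝ X y e i + 2 * (fderiv ℝ F y e * X y i))) = fun y =>
        F y * fderiv ℝ (fun y => F y * X y i) y e + fderiv ℝ F y e * (F y * X y i) := by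
      ext y
      rw [congrFun h1 y]
      ring
    rw [h4]
    exact ⟨hi1.add hi2, by rw [integral_add hi1 hi2, h3, neg_add_cancel]⟩
  have hdiv : ∫ y, ∑ i : Fin 3, F y * (F y * fderiv ℝ X y (EuclideanSpace.single i 1) i +
      2 * (fderiv ℝ F y (EuclideanSpace.single i 1) * X y i)) = 0 := by
    rw [integral_finsetSum _ fun i _ => (hparts i).1]
    exact Finset.sum_eq_zero fun i _ => (hparts i).2
  have hdivI := integrable_finsetSum (μ := (volume : Measure E3)) Finset.univ
    fun i _ => (hparts i).1
  have hsum : ∀ y, ∑ i : Fin 3, F y * (F y * fderiv ℝ X y (EuclideanSpace.single i 1) i +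
      2 * (fderiv ℝ F y (EuclideanSpace.single i 1) * X y i)) =
      F y ^ 2 * divergence X y + 2 * F y * fderiv ℝ F y (X y) := by
    intro y
    rw [← sum_apply_smul_single, divergence, Finset.mul_sum, Finset.mul_sum,
      ← Finset.sum_add_distrib]
    exact Finset.sum_congr rfl fun i _ => by ring
  have hI1 := integrable_sq_mul_divergence_sub hU hF.continuous hFc hFU hX
  have hI2 : Integrable fun y => ‖fderiv ℝ F y‖ ^ 2 :=
    Continuous.integrable_of_hasCompactSupport (by fun_prop)
      ((hFc.fderiv ℝ).comp_left (g := fun t : E3 →L[ℝ] ℝ => ‖t‖ ^ 2) (by simp))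
  rw [← sub_zero (∫ y, F y ^ 2 * (divergence X y - ‖X y‖ ^ 2)), ← hdiv, ← integral_sub hI1 hdivI]
  refine integral_mono (hI1.sub hdivI) hI2 fun y => ?_
  simp only
  rw [hsum]
  have h1 : |F y * fderiv ℝ F y (X y)| ≤ |F y| * (‖fderiv ℝ F y‖ * ‖X y‖) := by
    rw [abs_mul]
    exact mul_le_mul_of_nonneg_left ((fderiv ℝ F y).le_opNorm _) (abs_nonneg _)
  have h2 := neg_abs_le (F y * fderiv ℝ F y (X y))
  nlinarith [sq_nonneg (‖fderiv ℝ F y‖ - |F y| * ‖X y‖), sq_abs (F y)]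

end Barta

section LocalInverse

variable {E : Type*} [NormedAddCommGroup E] [NormedSpace ℝ E] [CompleteSpace E]
  {G : Type*} [NormedAddCommGroup G] [NormedSpace ℝ G]
  {H : Type*} [TopologicalSpace H] (I : ModelWithCorners ℝ E H) [I.Boundaryless]
  {M : Type*} [TopologicalSpace M] [ChartedSpace H M]

/-- The inverse function theorem for maps from a manifold without boundary to a normed space. -/
theorem exists_contMDiffAt_local_inverse {n : ℕ∞ω} [IsManifold I n M] (hn : n ≠ 0) {f : M → G}
    {z : M} (hf : ContMDiffAt I 𝓘(ℝ, G) n f z) (f' : E ≃L[ℝ] G)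
    (hf' : ∀ v : E, mfderiv I 𝓘(ℝ, G) f z v = f' v) :
    ∃ g : G → M, g (f z) = z ∧ ContMDiffAt 𝓘(ℝ, G) I n g (f z) ∧
      (∀ᶠ y in 𝓝 (f z), f (g y) = y) ∧ ∀ᶠ z' in 𝓝 z, g (f z') = z' := by
  set e := extChartAt I z with he
  let Φ : E → G := f ∘ e.symm
  have hΦ : ContDiffAt ℝ n Φ (e z) := by
    have := (contMDiffAt_iff.mp hf).2
    rwa [I.range_eq_univ, contDiffWithinAt_univ] at this
  have hmd : MDifferentiableAt I 𝓘(ℝ, G) f z := hf.mdifferentiableAt hn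
  have hΦ' : HasFDerivAt Φ (f' : E →L[ℝ] G) (e z) := by
    have h1 := (hΦ.differentiableAt hn).hasFDerivAt
    have h2 : fderiv ℝ Φ (e z) = (f' : E →L[ℝ] G) := by
      ext v
      have h3 := hf' v
      rw [hmd.mfderiv, I.range_eq_univ, fderivWithin_univ] at h3
      exact h3
    rwa [h2] at h1
  let R := hΦ.toOpenPartialHomeomorph Φ hΦ' hn
  have hR : ∀ y, R y = Φ y := fun y => rfl
  have hzR : e z ∈ R.source := hΦ.mem_toOpenPartialHomeomorph_source hΦ' hn
  have hΦz : Φ (e z) = f z := by simp [Φ, he]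
  have hzt : f z ∈ R.target := by
    rw [← hΦz]; exact hΦ.image_mem_toOpenPartialHomeomorph_target hΦ' hn
  have hRz : R.symm (f z) = e z := by rw [← hΦz, ← hR, R.left_inv hzR]
  refine ⟨e.symm ∘ R.symm, ?_, ?_, ?_, ?_⟩
  · simp [hRz, he]
  · have h1 : ContDiffAt ℝ n R.symm (f z) := by
      have := hΦ.to_localInverse hΦ' hn
      rwa [hΦz] at this
    have h2 : ContMDiffAt 𝓘(ℝ, E) I n e.symm (R.symm (f z)) := by
      rw [hRz]
      exact (contMDiffOn_extChartAt_symm z).contMDiffAt (extChartAt_target_mem_nhds z)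
    exact h2.comp (f z) h1.contMDiffAt
  · filter_upwards [R.open_target.mem_nhds hzt] with y hy
    exact R.right_inv hy
  · filter_upwards [(continuousAt_extChartAt z).preimage_mem_nhds (R.open_source.mem_nhds hzR),
      extChartAt_source_mem_nhds (I := I) z] with z' h1 h2
    have h3 : f z' = R (e z') := by simp [hR, Φ, e.left_inv h2]
    rw [Function.comp_apply, h3, R.left_inv h1, e.left_inv h2]

end LocalInverse

/-! ### Fermi coordinates of the layer -/

section FermiCoordinates

variable {S : Type*} [TopologicalSpace S] [ChartedSpace E2 S] {p N : S → E3} {a : ℝ}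

theorem isOpen_openLayer (S : Type*) [TopologicalSpace S] (a : ℝ) : IsOpen (openLayer S a) :=
  isOpen_univ.prod isOpen_Ioo

theorem openLayer_subset_layer (S : Type*) (a : ℝ) : openLayer S a ⊆ layer S a :=
  prod_mono subset_rfl Ioo_subset_Icc_self

theorem contMDiff_layerMap (h : IsQuantumLayer p N a) :
    ContMDiff ((𝓡 2).prod 𝓘(ℝ, ℝ)) 𝓘(ℝ, E3) ∞ (layerMap p N) :=
  (h.contMDiff_p.comp contMDiff_fst).add (contMDiff_snd.smul (h.contMDiff_N.comp contMDiff_fst))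

theorem hasMFDerivAt_layerMap (h : IsQuantumLayer p N a) (z : S × ℝ) :
    HasMFDerivAt ((𝓡 2).prod 𝓘(ℝ, ℝ)) 𝓘(ℝ, E3) (layerMap p N) z (layerDeriv p N z) :=
  ((contMDiff_layerMap h).mdifferentiable (by simp) z).hasMFDerivAt

theorem hasMFDerivAt_comp_fst {f : S → E3} (hf : ContMDiff (𝓡 2) 𝓘(ℝ, E3) ∞ f) (z : S × ℝ) :
    HasMFDerivAt ((𝓡 2).prod 𝓘(ℝ, ℝ)) 𝓘(ℝ, E3) (fun z : S × ℝ => f z.1) z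
      ((surfaceDeriv f z.1).comp (ContinuousLinearMap.fst ℝ E2 ℝ)) :=
  HasMFDerivAt.comp z (g := f) (hf.mdifferentiable (by simp) z.1).hasMFDerivAt (hasMFDerivAt_fst z)

theorem layerDeriv_apply (h : IsQuantumLayer p N a) (z : S × ℝ) (X : E2) (s : ℝ) :
    layerDeriv p N z (X, s) =
      surfaceDeriv p z.1 X + z.2 • surfaceDeriv N z.1 X + s • N z.1 := by
  have hp := (h.contMDiff_p.mdifferentiable (by simp) z.1).hasMFDerivAt
  have hN := (h.contMDiff_N.mdifferentiable (by simp) z.1).hasMFDerivAt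
  have h1 := (hp.add (hN.const_smul z.2)).mfderiv
  have h2 : HasFDerivAt (fun t : ℝ => p z.1 + t • N z.1)
      ((ContinuousLinearMap.id ℝ ℝ).smulRight (N z.1)) z.2 :=
    ((ContinuousLinearMap.id ℝ ℝ).hasFDerivAt.smul_const (N z.1)).const_add _
  have h3 := h2.hasMFDerivAt.mfderiv
  have h4 := mfderiv_prod_eq_add_apply (I := 𝓡 2) (I' := 𝓘(ℝ, ℝ)) (I'' := 𝓘(ℝ, E3))
    (f := layerMap p N) (p := z) (v := ((X, s) : E2 × ℝ))
    (hasMFDerivAt_layerMap h z).mdifferentiableAt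
  refine Eq.trans h4 ?_
  refine congrArg₂ (· + ·) ?_ ?_
  · exact congrArg (fun L : E2 →L[ℝ] E3 => L X) h1
  · exact congrArg (fun L : ℝ →L[ℝ] E3 => L s) h3

theorem exists_layerDeriv_equiv {z : S × ℝ} (hz : Function.Injective (layerDeriv p N z)) :
    ∃ e : (E2 × ℝ) ≃L[ℝ] E3, layerDeriv p N z = e := by
  have hd : Module.finrank ℝ (E2 × ℝ) = Module.finrank ℝ E3 := by simp
  refine ⟨(LinearEquiv.ofInjectiveOfFinrankEq
    (layerDeriv p N z : E2 × ℝ →ₗ[ℝ] E3) hz hd).toContinuousLinearEquiv, ?_⟩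
  ext1 <;> ext1 <;> rfl

/-- The derivative of the unit normal field is tangential. -/
theorem inner_surfaceDeriv_normal (h : IsQuantumLayer p N a) (x : S) (X : E2) :
    ⟪surfaceDeriv N x X, N x⟫ = 0 := by
  have hN : HasMFDerivAt (𝓡 2) 𝓘(ℝ, E3) N x (surfaceDeriv N x) :=
    (h.contMDiff_N.mdifferentiable (by simp) x).hasMFDerivAt
  have h1 : HasFDerivAt (fun v : E3 => ‖v‖ ^ 2) (2 • innerSL ℝ (N x)) (N x) :=
    (hasStrictFDerivAt_norm_sq (N x)).hasFDerivAt
  have h2 := (h1.hasMFDerivAt.comp x hN).mfderiv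
  have h3 : (fun v : E3 => ‖v‖ ^ 2) ∘ N = fun _ => (1 : ℝ) := by
    ext y; simp [h.norm_N]
  have h4 : mfderiv (𝓡 2) 𝓘(ℝ, ℝ) ((fun v : E3 => ‖v‖ ^ 2) ∘ N) x = 0 := by
    rw [h3]; exact mfderiv_const
  rw [h2] at h4
  have h5 : (2 • innerSL ℝ (N x)) (surfaceDeriv N x X) = 0 :=
    congrArg (fun L : E2 →L[ℝ] ℝ => L X) h4
  have h6 : (2 : ℕ) • ⟪N x, surfaceDeriv N x X⟫ = 0 := h5
  rw [real_inner_comm]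
  simpa using h6

theorem surjective_layerDeriv (h : IsQuantumLayer p N a) {z : S × ℝ} (hz : z ∈ layer S a) :
    Function.Surjective (layerDeriv p N z) := by
  obtain ⟨e, he⟩ := exists_layerDeriv_equiv (h.immersion z hz)
  rw [he]; exact e.surjective

/-- In Fermi coordinates, `∂ₜ` is the unit normal and the gradient of `t`. -/
theorem inner_normal_layerDeriv (h : IsQuantumLayer p N a) (z : S × ℝ) (X : E2) (s : ℝ) :
    ⟪N z.1, layerDeriv p N z (X, s)⟫ = s := by
  rw [layerDeriv_apply h, inner_add_right, inner_add_right, real_inner_smul_right,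
    real_inner_smul_right, real_inner_comm, h.normal_N, real_inner_comm,
    inner_surfaceDeriv_normal h, real_inner_self_eq_norm_sq, h.norm_N]
  simp

/-- A bound on the second fundamental form bounds the derivative of the normal field. -/
theorem norm_surfaceDeriv_normal_le (h : IsQuantumLayer p N a) {x : S} {ε : ℝ}
    (hε : ∀ X Y : E2, |secondFundamentalForm p N x X Y| ≤
      ε * ‖surfaceDeriv p x X‖ * ‖surfaceDeriv p x Y‖) (X : E2) :
    ‖surfaceDeriv N x X‖ ≤ ε * ‖surfaceDeriv p x X‖ := by
  have hx : ((x, 0) : S × ℝ) ∈ layer S a := ⟨mem_univ _, by linarith [h.pos], h.pos.le⟩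
  obtain ⟨⟨Y, s⟩, hY⟩ := surjective_layerDeriv h hx (surfaceDeriv N x X)
  have hs : s = 0 := by
    rw [← inner_normal_layerDeriv h (x, 0) Y s, hY, real_inner_comm]
    exact inner_surfaceDeriv_normal h x X
  rw [layerDeriv_apply h, hs] at hY
  simp only [zero_smul, add_zero] at hY
  have h1 := hε X Y
  rw [secondFundamentalForm, hY, abs_neg, real_inner_self_eq_norm_sq, abs_of_nonneg (by positivity)]
    at h1
  rcases (norm_nonneg (surfaceDeriv N x X)).eq_or_lt with h2 | h2
  · rw [← h2] at h1 ⊢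
    have h3 := hε X X
    rcases (norm_nonneg (surfaceDeriv p x X)).eq_or_lt with h4 | h4
    · rw [← h4, mul_zero]
    · by_contra! h5
      have h6 := abs_nonneg (secondFundamentalForm p N x X X)
      nlinarith
  · refine le_of_mul_le_mul_right ?_ h2
    nlinarith

theorem norm_surfaceDeriv_normal_le_layerDeriv (h : IsQuantumLayer p N a) {z : S × ℝ}
    (hz : z ∈ layer S a) {ε : ℝ} (hε0 : 0 ≤ ε) (hεa : a * ε ≤ 1 / 2)
    (hε : ∀ X Y : E2, |secondFundamentalForm p N z.1 X Y| ≤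
      ε * ‖surfaceDeriv p z.1 X‖ * ‖surfaceDeriv p z.1 Y‖) (X : E2) (s : ℝ) :
    ‖surfaceDeriv N z.1 X‖ ≤ 2 * ε * ‖layerDeriv p N z (X, s)‖ := by
  have h1 := norm_surfaceDeriv_normal_le h hε X
  set w := surfaceDeriv p z.1 X + z.2 • surfaceDeriv N z.1 X with hw
  have h2 : ‖surfaceDeriv p z.1 X‖ ≤ 2 * ‖w‖ := by
    have h3 : ‖surfaceDeriv p z.1 X‖ ≤ ‖w‖ + ‖z.2 • surfaceDeriv N z.1 X‖ := by
      have := norm_sub_le w (z.2 • surfaceDeriv N z.1 X)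
      rwa [hw, add_sub_cancel_right] at this
    have h4 : ‖z.2 • surfaceDeriv N z.1 X‖ ≤ 1 / 2 * ‖surfaceDeriv p z.1 X‖ := by
      rw [norm_smul]
      have h5 : ‖z.2‖ ≤ a := abs_le.mpr hz.2
      have ha := h.pos.le
      calc ‖z.2‖ * ‖surfaceDeriv N z.1 X‖ ≤ a * (ε * ‖surfaceDeriv p z.1 X‖) := by gcongr
        _ = a * ε * ‖surfaceDeriv p z.1 X‖ := by ring
        _ ≤ _ := by gcongr
    linarith
  have h6 : ‖w‖ ≤ ‖layerDeriv p N z (X, s)‖ := by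
    have h7 : layerDeriv p N z (X, s) = w + s • N z.1 := layerDeriv_apply h z X s
    have h8 : ⟪w, s • N z.1⟫ = 0 := by
      rw [hw, inner_add_left, real_inner_smul_left, real_inner_smul_right, real_inner_smul_right,
        h.normal_N, inner_surfaceDeriv_normal h]
      simp
    rw [h7]
    refine le_of_sq_le_sq ?_ (norm_nonneg _)
    rw [norm_add_sq_real w, h8]
    nlinarith [sq_nonneg ‖s • N z.1‖]
  calc _ ≤ ε * ‖surfaceDeriv p z.1 X‖ := h1
    _ ≤ ε * (2 * ‖layerDeriv p N z (X, s)‖) := by gcongr; linarith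
    _ = _ := by ring

variable [IsManifold (𝓡 2) ∞ S]

theorem exists_local_inverse_layerMap (h : IsQuantumLayer p N a) {z : S × ℝ} (hz : z ∈ layer S a) :
    ∃ g : E3 → S × ℝ, g (layerMap p N z) = z ∧
      ContMDiffAt 𝓘(ℝ, E3) ((𝓡 2).prod 𝓘(ℝ, ℝ)) ∞ g (layerMap p N z) ∧
      (∀ᶠ y in 𝓝 (layerMap p N z), layerMap p N (g y) = y) ∧
      ∀ᶠ z' in 𝓝 z, g (layerMap p N z') = z' := by
  obtain ⟨e, he⟩ := exists_layerDeriv_equiv (h.immersion z hz)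
  refine exists_contMDiffAt_local_inverse ((𝓡 2).prod 𝓘(ℝ, ℝ)) (by simp)
    (contMDiff_layerMap h z) e fun v => ?_
  exact congrArg (fun L : E2 × ℝ →L[ℝ] E3 => L v) he

theorem isOpenEmbedding_layerMap (h : IsQuantumLayer p N a) :
    IsOpenEmbedding ((openLayer S a).domRestrict (layerMap p N)) := by
  refine ⟨h.embedding.comp (IsEmbedding.inclusion (openLayer_subset_layer S a)), ?_⟩
  rw [Set.range_domRestrict, isOpen_iff_mem_nhds]
  rintro _ ⟨z, hz, rfl⟩
  obtain ⟨g, hgz, hg, hg1, -⟩ := exists_local_inverse_layerMap h (openLayer_subset_layer S a hz)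
  have h1 : ∀ᶠ y in 𝓝 (layerMap p N z), g y ∈ openLayer S a :=
    hg.continuousAt.eventually_mem (by rw [hgz]; exact (isOpen_openLayer S a).mem_nhds hz)
  filter_upwards [h1, hg1] with y hy1 hy2
  exact ⟨g y, hy1, hy2⟩

theorem isOpen_image_layerMap (h : IsQuantumLayer p N a) :
    IsOpen (layerMap p N '' openLayer S a) := by
  rw [← Set.range_domRestrict]; exact (isOpenEmbedding_layerMap h).isOpen_range

section Pushforward

variable {G : Type*} [NormedAddCommGroup G]

/-- The function `f ∘ p̃⁻¹` on the image of the open layer in `ℝ³`, extended by zero. -/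
def pushforward (p N : S → E3) (a : ℝ) (f : S × ℝ → G) : E3 → G :=
  Function.extend ((openLayer S a).domRestrict (layerMap p N)) ((openLayer S a).domRestrict f) 0

theorem pushforward_layerMap (h : IsQuantumLayer p N a) (f : S × ℝ → G) {z : S × ℝ}
    (hz : z ∈ openLayer S a) : pushforward p N a f (layerMap p N z) = f z :=
  (isOpenEmbedding_layerMap h).injective.extend_apply ((openLayer S a).domRestrict f) 0 ⟨z, hz⟩

omit [ChartedSpace E2 S] [TopologicalSpace S] [IsManifold (𝓡 2) ∞ S] in
theorem pushforward_of_notMem (f : S × ℝ → G) {y : E3} (hy : y ∉ layerMap p N '' openLayer S a) :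
    pushforward p N a f y = 0 := by
  refine Function.extend_apply' _ _ _ ?_
  rintro ⟨z, rfl⟩
  exact hy ⟨z, z.2, rfl⟩

/-- Near the image of a point of the open layer, any continuous local inverse of `p̃` expresses the
push-forward. -/
theorem pushforward_eventuallyEq_comp (h : IsQuantumLayer p N a) (f : S × ℝ → G) {z : S × ℝ}
    {g : E3 → S × ℝ} (hgz : g (layerMap p N z) = z) (hg : ContinuousAt g (layerMap p N z))
    (hg1 : ∀ᶠ y in 𝓝 (layerMap p N z), layerMap p N (g y) = y) (hz : z ∈ openLayer S a) :
    pushforward p N a f =ᶠ[𝓝 (layerMap p N z)] f ∘ g := by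
  have h1 : ∀ᶠ y in 𝓝 (layerMap p N z), g y ∈ openLayer S a :=
    hg.eventually_mem (by rw [hgz]; exact (isOpen_openLayer S a).mem_nhds hz)
  filter_upwards [h1, hg1] with y hy1 hy2
  rw [Function.comp_apply, ← pushforward_layerMap h f hy1, hy2]

variable [NormedSpace ℝ G]

theorem contDiffAt_pushforward (h : IsQuantumLayer p N a) {f : S × ℝ → G}
    (hf : ContMDiff ((𝓡 2).prod 𝓘(ℝ, ℝ)) 𝓘(ℝ, G) ∞ f) {z : S × ℝ} (hz : z ∈ openLayer S a) :
    ContDiffAt ℝ ∞ (pushforward p N a f) (layerMap p N z) := by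
  obtain ⟨g, hgz, hg, hg1, -⟩ := exists_local_inverse_layerMap h (openLayer_subset_layer S a hz)
  have h1 : ContMDiffAt 𝓘(ℝ, E3) 𝓘(ℝ, G) ∞ (f ∘ g) (layerMap p N z) := hf.contMDiffAt.comp _ hg
  exact h1.contDiffAt.congr_of_eventuallyEq
    (pushforward_eventuallyEq_comp h f hgz hg.continuousAt hg1 hz)

theorem hasMFDerivAt_of_pushforward (h : IsQuantumLayer p N a) {f : S × ℝ → G}
    (hf : ContMDiff ((𝓡 2).prod 𝓘(ℝ, ℝ)) 𝓘(ℝ, G) ∞ f) {z : S × ℝ} (hz : z ∈ openLayer S a) :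
    HasMFDerivAt ((𝓡 2).prod 𝓘(ℝ, ℝ)) 𝓘(ℝ, G) f z
      ((fderiv ℝ (pushforward p N a f) (layerMap p N z)).comp (layerDeriv p N z)) := by
  have h1 := ((contDiffAt_pushforward h hf hz).differentiableAt (by simp)).hasFDerivAt.hasMFDerivAt
  have h2 := h1.comp z (hasMFDerivAt_layerMap h z)
  refine h2.congr_of_eventuallyEq ?_
  filter_upwards [(isOpen_openLayer S a).mem_nhds hz] with z' hz'
  exact (pushforward_layerMap h f hz').symm

end Pushforward

end FermiCoordinates

/-! ### The comparison field and the localized form bound -/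

section FermiField

variable {S : Type*} [TopologicalSpace S] [ChartedSpace E2 S] [IsManifold (𝓡 2) ∞ S]
  {p N : S → E3} {a : ℝ}

theorem fderiv_pushforward_normal (h : IsQuantumLayer p N a) {z : S × ℝ} (hz : z ∈ openLayer S a)
    (X : E2) (s : ℝ) :
    fderiv ℝ (pushforward p N a fun z => N z.1) (layerMap p N z) (layerDeriv p N z (X, s)) =
      surfaceDeriv N z.1 X := by
  have h1 := hasMFDerivAt_of_pushforward h (h.contMDiff_N.comp contMDiff_fst) hz
  have h2 := hasMFDerivAt_unique h1 (hasMFDerivAt_comp_fst h.contMDiff_N z)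
  exact congrArg (fun L : E2 × ℝ →L[ℝ] E3 => L (X, s)) h2

/-- The gradient of the signed distance `t` to the surface is the unit normal. -/
theorem fderiv_pushforward_snd (h : IsQuantumLayer p N a) {z : S × ℝ} (hz : z ∈ openLayer S a) :
    fderiv ℝ (pushforward p N a fun z => z.2) (layerMap p N z) = innerSL ℝ (N z.1) := by
  have h1 := hasMFDerivAt_of_pushforward h (f := fun z : S × ℝ => z.2) contMDiff_snd hz
  have h2 := hasMFDerivAt_unique h1 (hasMFDerivAt_snd z)
  ext v
  obtain ⟨⟨X, s⟩, rfl⟩ := surjective_layerDeriv h (openLayer_subset_layer S a hz) v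
  rw [innerSL_apply_apply, inner_normal_layerDeriv h]
  exact congrArg (fun L : E2 × ℝ →L[ℝ] ℝ => L (X, s)) h2

/-- The radial field `τ(t) N` of the layer, as a vector field on `ℝ³`. -/
def fermiField (p N : S → E3) (a : ℝ) (τ : ℝ → ℝ) (y : E3) : E3 :=
  τ (pushforward p N a (fun z => z.2) y) • pushforward p N a (fun z => N z.1) y

theorem contDiffOn_fermiField (h : IsQuantumLayer p N a) {τ : ℝ → ℝ}
    (hτ : ∀ t ∈ Ioo (-a) a, ContDiffAt ℝ 1 τ t) :
    ContDiffOn ℝ 1 (fermiField p N a τ) (layerMap p N '' openLayer S a) := by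
  rintro _ ⟨z, hz, rfl⟩
  have h1 := (contDiffAt_pushforward h (f := fun z : S × ℝ => z.2) contMDiff_snd hz).of_le
    (m := 1) (by simp)
  have h2 := (contDiffAt_pushforward h (h.contMDiff_N.comp contMDiff_fst) hz).of_le
    (m := 1) (by simp)
  have h3 : ContDiffAt ℝ 1 τ (pushforward p N a (fun z => z.2) (layerMap p N z)) := by
    rw [pushforward_layerMap h _ hz]
    exact hτ _ hz.2
  exact ((h3.comp _ h1).smul h2).contDiffWithinAt

theorem norm_fermiField (h : IsQuantumLayer p N a) (τ : ℝ → ℝ) {z : S × ℝ}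
    (hz : z ∈ openLayer S a) : ‖fermiField p N a τ (layerMap p N z)‖ ^ 2 = τ z.2 ^ 2 := by
  rw [fermiField, pushforward_layerMap h _ hz, pushforward_layerMap h _ hz, norm_smul, h.norm_N,
    mul_one, Real.norm_eq_abs, sq_abs]

theorem divergence_fermiField (h : IsQuantumLayer p N a) {τ : ℝ → ℝ} {z : S × ℝ}
    (hz : z ∈ openLayer S a) {τ' : ℝ} (hτ : HasDerivAt τ τ' z.2) :
    divergence (fermiField p N a τ) (layerMap p N z) = τ' +
      τ z.2 * divergence (pushforward p N a fun z => N z.1) (layerMap p N z) := by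
  set y := layerMap p N z
  have hz2 : pushforward p N a (fun z => z.2) y = z.2 := pushforward_layerMap h _ hz
  have hzN : pushforward p N a (fun z => N z.1) y = N z.1 := pushforward_layerMap h _ hz
  have h1 := ((contDiffAt_pushforward h (f := fun z : S × ℝ => z.2)
    contMDiff_snd hz).differentiableAt (by simp)).hasFDerivAt
  have h2 : HasFDerivAt (pushforward p N a fun z => N z.1)
      (fderiv ℝ (pushforward p N a fun z => N z.1) y) y :=
    ((contDiffAt_pushforward h (h.contMDiff_N.comp contMDiff_fst) hz).differentiableAt
    (by simp)).hasFDerivAt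
  rw [fderiv_pushforward_snd h hz] at h1
  rw [← hz2] at hτ
  have h3 := (hτ.comp_hasFDerivAt y h1).smul h2
  have h4 : ∀ v, fderiv ℝ (fermiField p N a τ) y v =
      τ z.2 • fderiv ℝ (pushforward p N a fun z => N z.1) y v + (τ' * ⟪N z.1, v⟫) • N z.1 := by
    intro v
    have h5 := h3.fderiv
    have h6 : fderiv ℝ (fermiField p N a τ) y v = _ :=
      congrArg (fun L : E3 →L[ℝ] E3 => L v) h5
    rw [h6]
    simp [hz2, hzN]
  have h7 : ∑ i, N z.1 i * N z.1 i = 1 := by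
    have := h.norm_N z.1
    rw [EuclideanSpace.norm_eq, Real.sqrt_eq_one] at this
    simpa [← sq] using this
  simp only [divergence, h4, PiLp.add_apply, PiLp.smul_apply, smul_eq_mul, Finset.sum_add_distrib,
    ← Finset.mul_sum]
  have h8 : ∀ i, ⟪N z.1, (EuclideanSpace.single i 1 : E3)⟫ = N z.1 i := fun i => by
    rw [EuclideanSpace.inner_single_right]; simp
  simp only [h8, mul_assoc, ← Finset.mul_sum, h7]
  ring

theorem norm_fderiv_pushforward_normal_le (h : IsQuantumLayer p N a) {z : S × ℝ}
    (hz : z ∈ openLayer S a) {ε : ℝ} (hε0 : 0 ≤ ε) (hεa : a * ε ≤ 1 / 2)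
    (hε : ∀ X Y : E2, |secondFundamentalForm p N z.1 X Y| ≤
      ε * ‖surfaceDeriv p z.1 X‖ * ‖surfaceDeriv p z.1 Y‖) :
    ‖fderiv ℝ (pushforward p N a fun z => N z.1) (layerMap p N z)‖ ≤ 2 * ε := by
  refine ContinuousLinearMap.opNorm_le_bound _ (by positivity) fun v => ?_
  obtain ⟨⟨X, s⟩, rfl⟩ := surjective_layerDeriv h (openLayer_subset_layer S a hz) v
  rw [fderiv_pushforward_normal h hz]
  exact norm_surfaceDeriv_normal_le_layerDeriv h (openLayer_subset_layer S a hz) hε0 hεa hε X s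

/-- The derivative of the extended normal field stays bounded up to the boundary of the layer, since
`p̃` is an immersion there too. -/
theorem exists_bound_fderiv_pushforward_normal (h : IsQuantumLayer p N a) {K : Set (S × ℝ)}
    (hK : IsCompact K) (hKl : K ⊆ layer S a) :
    ∃ C, ∀ z ∈ K, z ∈ openLayer S a →
      ‖fderiv ℝ (pushforward p N a fun z => N z.1) (layerMap p N z)‖ ≤ C := by
  refine hK.induction_on (p := fun s => ∃ C, ∀ z ∈ s, z ∈ openLayer S a →
      ‖fderiv ℝ (pushforward p N a fun z => N z.1) (layerMap p N z)‖ ≤ C) ⟨0, by simp⟩ ?_ ?_ ?_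
  · rintro s t hst ⟨C, hC⟩
    exact ⟨C, fun z hz => hC z (hst hz)⟩
  · rintro s t ⟨C, hC⟩ ⟨D, hD⟩
    refine ⟨max C D, fun z hz hz' => ?_⟩
    rcases hz with hz | hz
    · exact (hC z hz hz').trans (le_max_left _ _)
    · exact (hD z hz hz').trans (le_max_right _ _)
  · intro z hz
    -- Near `z`, which may lie on the boundary, the extended normal is `N ∘ fst ∘ g`, for a local
    -- inverse `g` of `p̃` that is smooth across the boundary.
    obtain ⟨g, hgz, hg, hg1, hg2⟩ := exists_local_inverse_layerMap h (hKl hz)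
    have hP : Continuous (layerMap p N) := (contMDiff_layerMap h).continuous
    have h1 : ContDiffAt ℝ 1 (fun y => N (g y).1) (layerMap p N z) := by
      have h1 : ContMDiffAt 𝓘(ℝ, E3) 𝓘(ℝ, E3) ∞ ((fun z : S × ℝ => N z.1) ∘ g) (layerMap p N z) :=
        (h.contMDiff_N.comp contMDiff_fst).contMDiffAt.comp _ hg
      exact h1.contDiffAt.of_le (by simp)
    have h2 : ContinuousAt (fderiv ℝ fun y => N (g y).1) (layerMap p N z) :=
      (h1.fderiv_right (m := 0) (by simp)).continuousAt
    have h3 : ∀ᶠ y in 𝓝 (layerMap p N z), ‖fderiv ℝ (fun y => N (g y).1) y‖ <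
        ‖fderiv ℝ (fun y => N (g y).1) (layerMap p N z)‖ + 1 :=
      h2.norm.eventually_lt continuousAt_const (by simp)
    have h4 : ∀ᶠ y in 𝓝 (layerMap p N z), ContinuousAt g y := by
      have : IsManifold ((𝓡 2).prod 𝓘(ℝ, ℝ)) 1 (S × ℝ) := IsManifold.of_le (n := ∞) (by simp)
      have := (contMDiffAt_iff_contMDiffAt_nhds (by simp)).mp (hg.of_le (m := 1) (by simp))
      filter_upwards [this] with y hy using hy.continuousAt
    refine ⟨_, mem_nhdsWithin_of_mem_nhds (((hP.tendsto z).eventually h3).and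
      (((hP.tendsto z).eventually h4).and
        (((hP.tendsto z).eventually hg1.eventually_nhds).and hg2))),
      ‖fderiv ℝ (fun y => N (g y).1) (layerMap p N z)‖ + 1, ?_⟩
    rintro z' ⟨h5, h6, h7, h8⟩ hz'
    rw [(pushforward_eventuallyEq_comp h (fun z => N z.1) h8 h6 h7 hz').fderiv_eq]
    exact h5.le

/-- The comparison function: `τ = β tan (β t)` solves `τ' - τ² = β²`. -/
theorem hasDerivAt_mul_tan {β t : ℝ} (hc : Real.cos (β * t) ≠ 0) :
    HasDerivAt (fun t => β * Real.tan (β * t)) (β ^ 2 + (β * Real.tan (β * t)) ^ 2) t := by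
  have h1 : HasDerivAt (fun t => β * t) β t := by simpa using (hasDerivAt_id t).const_mul β
  have h2 := ((Real.hasDerivAt_tan hc).comp t h1).const_mul β
  refine h2.congr_deriv ?_
  rw [Real.tan_eq_sin_div_cos]
  field_simp
  rw [Real.cos_sq']; ring

/-- The field `τ(t) N` with `τ = β tan (β t)` and `β < π / (2 a)` has `div X - |X|² ≥ c₁` away from
a compact set, and `div X - |X|²` is bounded below. -/
theorem exists_fermiField_bound (h : IsQuantumLayer p N a) (hflat : AsymptoticallyFlat p N)
    {c₁ : ℝ} (hc₁ : c₁ < Real.pi ^ 2 / (4 * a ^ 2)) :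
    ∃ (K : Set (S × ℝ)) (M : ℝ) (τ : ℝ → ℝ), IsCompact K ∧ K ⊆ layer S a ∧ 0 ≤ M ∧
      (∀ t ∈ Ioo (-a) a, ContDiffAt ℝ 1 τ t) ∧
      ∀ z ∈ openLayer S a, c₁ - K.indicator (fun _ => M) z ≤
        divergence (fermiField p N a τ) (layerMap p N z) -
          ‖fermiField p N a τ (layerMap p N z)‖ ^ 2 := by
  have ha := h.pos
  have hpi := Real.pi_pos
  obtain ⟨β, hβ1, hβ2⟩ : ∃ β, √c₁ < β ∧ β < Real.pi / (2 * a) := by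
    refine exists_between ?_
    rw [Real.sqrt_lt' (by positivity)]
    convert hc₁ using 1
    field_simp
    norm_num
  have hβ0 : 0 < β := (Real.sqrt_nonneg _).trans_lt hβ1
  have hβc : c₁ < β ^ 2 := Real.lt_sq_of_sqrt_lt hβ1
  have hβa : β * a < Real.pi / 2 := by
    rw [lt_div_iff₀ (by positivity)] at hβ2
    linarith
  have hcos : ∀ t ∈ Icc (-a) a, Real.cos (β * t) ≠ 0 := fun t ht => by
    refine (Real.cos_pos_of_mem_Ioo ⟨?_, ?_⟩).ne'
    · nlinarith [ht.1]
    · nlinarith [ht.2]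
  obtain ⟨A, hA⟩ : ∃ A, ∀ t ∈ Icc (-a) a, ‖β * Real.tan (β * t)‖ ≤ A :=
    isCompact_Icc.exists_bound_of_continuousOn fun t ht =>
      (hasDerivAt_mul_tan (hcos t ht)).continuousAt.continuousWithinAt
  have hA0 : 0 ≤ A := (norm_nonneg _).trans (hA 0 ⟨by linarith, ha.le⟩)
  -- The first bound gives `‖dp X‖ ≤ 2 ‖dp X + t dN X‖`, the second makes the error
  -- `|τ div N| ≤ A * 3 * (2 ε)` at most `β² - c₁`; `A + 1` avoids a division by zero.
  let ε := min (1 / (2 * a)) ((β ^ 2 - c₁) / (6 * (A + 1)))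
  have hε0 : 0 < ε := lt_min (by positivity) (div_pos (by linarith) (by positivity))
  have hεa : a * ε ≤ 1 / 2 := by
    calc a * ε ≤ a * (1 / (2 * a)) := by gcongr; exact min_le_left _ _
      _ = 1 / 2 := by field_simp
  have hεA : 6 * A * ε ≤ β ^ 2 - c₁ := by
    calc 6 * A * ε ≤ 6 * (A + 1) * ((β ^ 2 - c₁) / (6 * (A + 1))) := by
          gcongr
          · linarith
          · exact min_le_right _ _
      _ = _ := by field_simp
  obtain ⟨K₀, hK₀, hK₀ε⟩ := mem_cocompact.mp (hflat ε hε0)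
  have hK : IsCompact (K₀ ×ˢ Icc (-a) a) := hK₀.prod isCompact_Icc
  have hKl : K₀ ×ˢ Icc (-a) a ⊆ layer S a := prod_mono (subset_univ _) subset_rfl
  obtain ⟨C, hC⟩ := exists_bound_fderiv_pushforward_normal h hK hKl
  refine ⟨K₀ ×ˢ Icc (-a) a, |c₁| + A * (3 * |C|), fun t => β * Real.tan (β * t), hK, hKl,
    by positivity, fun t ht => ?_, fun z hz => ?_⟩
  · exact contDiffAt_const.mul ((Real.contDiffAt_tan.mpr (hcos t (Ioo_subset_Icc_self ht))).comp t
      (contDiffAt_const.mul contDiffAt_id))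
  · have hz' := Ioo_subset_Icc_self hz.2
    rw [norm_fermiField h _ hz, divergence_fermiField h hz (hasDerivAt_mul_tan (hcos _ hz'))]
    set d := divergence (pushforward p N a fun z => N z.1) (layerMap p N z) with hd
    have h1 : |d| ≤ 3 * ‖fderiv ℝ (pushforward p N a fun z => N z.1) (layerMap p N z)‖ :=
      abs_sum_apply_single_le _
    have h2 : ∀ D, ‖fderiv ℝ (pushforward p N a fun z => N z.1) (layerMap p N z)‖ ≤ D →
        -(A * (3 * D)) ≤ β * Real.tan (β * z.2) * d := fun D hD => by
      have h3 : |β * Real.tan (β * z.2) * d| ≤ A * (3 * D) := by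
        rw [abs_mul]
        exact mul_le_mul (hA _ hz') (h1.trans (by linarith)) (abs_nonneg _) hA0
      exact (abs_le.mp h3).1
    by_cases hzK : z ∈ K₀ ×ˢ Icc (-a) a
    · rw [indicator_of_mem hzK]
      have := h2 |C| ((hC z hzK hz).trans (le_abs_self C))
      nlinarith [le_abs_self c₁, sq_nonneg β]
    · rw [indicator_of_notMem hzK]
      have hz1 : z.1 ∉ K₀ := fun h => hzK ⟨h, hz'⟩
      have := h2 _ (norm_fderiv_pushforward_normal_le h hz hε0.le hεa (hK₀ε hz1))
      nlinarith

end FermiField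

section TestFunctions

variable {S : Type*} [TopologicalSpace S] [ChartedSpace E2 S] [IsManifold (𝓡 2) ∞ S]
  {p N : S → E3} {a : ℝ}

theorem tsupport_pushforward_subset (h : IsQuantumLayer p N a) {f : S × ℝ → ℝ}
    (hf : IsTestFunction a f) : tsupport (pushforward p N a f) ⊆ layerMap p N '' tsupport f := by
  have hc : IsCompact (layerMap p N '' tsupport f) :=
    hf.hasCompactSupport.isCompact.image (contMDiff_layerMap h).continuous
  refine closure_minimal (fun y hy => ?_) hc.isClosed
  by_cases hyU : y ∈ layerMap p N '' openLayer S a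
  · obtain ⟨z, hz, rfl⟩ := hyU
    rw [Function.mem_support, pushforward_layerMap h f hz] at hy
    exact ⟨z, subset_tsupport f hy, rfl⟩
  · exact absurd (pushforward_of_notMem f hyU) hy

theorem tsupport_pushforward_subset_image (h : IsQuantumLayer p N a) {f : S × ℝ → ℝ}
    (hf : IsTestFunction a f) :
    tsupport (pushforward p N a f) ⊆ layerMap p N '' openLayer S a :=
  (tsupport_pushforward_subset h hf).trans (image_mono hf.tsupport_subset)

theorem hasCompactSupport_pushforward (h : IsQuantumLayer p N a) {f : S × ℝ → ℝ}
    (hf : IsTestFunction a f) : HasCompactSupport (pushforward p N a f) :=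
  (hf.hasCompactSupport.isCompact.image (contMDiff_layerMap h).continuous).of_isClosed_subset
    (isClosed_tsupport _) (tsupport_pushforward_subset h hf)

theorem contDiff_pushforward (h : IsQuantumLayer p N a) {f : S × ℝ → ℝ}
    (hf : IsTestFunction a f) : ContDiff ℝ 1 (pushforward p N a f) := by
  refine contDiff_iff_contDiffAt.mpr fun y => ?_
  by_cases hy : y ∈ tsupport (pushforward p N a f)
  · obtain ⟨z, hz, rfl⟩ := tsupport_pushforward_subset_image h hf hy
    exact (contDiffAt_pushforward h hf.contMDiff hz).of_le (by simp)
  · refine (contDiffAt_const (c := (0 : ℝ))).congr_of_eventuallyEq ?_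
    exact notMem_tsupport_iff_eventuallyEq.mp hy

/-- Localized lower bound for the Dirichlet form, in Euclidean terms. -/
theorem exists_dirichlet_lower_bound (h : IsQuantumLayer p N a) (hflat : AsymptoticallyFlat p N)
    {c₁ : ℝ} (hc₁ : c₁ < Real.pi ^ 2 / (4 * a ^ 2)) :
    ∃ (K : Set (S × ℝ)) (M : ℝ), IsCompact K ∧ K ⊆ layer S a ∧ 0 ≤ M ∧
      ∀ f, IsTestFunction a f → c₁ * (∫ y, pushforward p N a f y ^ 2) ≤
        (∫ y, ‖fderiv ℝ (pushforward p N a f) y‖ ^ 2) +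
          M * ∫ y in layerMap p N '' K, pushforward p N a f y ^ 2 := by
  obtain ⟨K, M, τ, hK, hKl, hM, hτ, hbound⟩ := exists_fermiField_bound h hflat hc₁
  refine ⟨K, M, hK, hKl, hM, fun f hf => ?_⟩
  set F := pushforward p N a f
  set X := fermiField p N a τ
  have hF := contDiff_pushforward h hf
  have hFc := hasCompactSupport_pushforward h hf
  have hFU := tsupport_pushforward_subset_image h hf
  have hX := contDiffOn_fermiField h hτ
  have hU := isOpen_image_layerMap h
  have hKm : MeasurableSet (layerMap p N '' K) :=
    (hK.image (contMDiff_layerMap h).continuous).isClosed.measurableSet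
  have h1 := integral_sq_mul_divergence_le hU hF hFc hFU hX
  have hI1 := integrable_sq_mul_divergence_sub hU hF.continuous hFc hFU hX
  have hI2 : Integrable (fun y => F y ^ 2) (volume : Measure E3) :=
    Continuous.integrable_of_hasCompactSupport (hF.continuous.pow 2)
      (hFc.comp_left (g := fun t : ℝ => t ^ 2) (by simp))
  have hI3 : Integrable ((layerMap p N '' K).indicator fun y => F y ^ 2) := hI2.indicator hKm
  rw [← integral_indicator hKm]
  suffices c₁ * (∫ y, F y ^ 2) - M * (∫ y, (layerMap p N '' K).indicator (fun y => F y ^ 2) y) ≤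
      ∫ y, F y ^ 2 * (divergence X y - ‖X y‖ ^ 2) by linarith
  rw [← integral_const_mul, ← integral_const_mul,
    ← integral_sub (hI2.const_mul c₁) (hI3.const_mul M)]
  refine integral_mono ((hI2.const_mul c₁).sub (hI3.const_mul M)) hI1 fun y => ?_
  simp only
  by_cases hy : y ∈ layerMap p N '' openLayer S a
  · obtain ⟨z, hz, rfl⟩ := hy
    have h2 := mul_le_mul_of_nonneg_left (hbound z hz) (sq_nonneg (F (layerMap p N z)))
    refine le_trans ?_ h2
    by_cases hzK : z ∈ K
    · rw [indicator_of_mem hzK, indicator_of_mem (mem_image_of_mem _ hzK)]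
      apply le_of_eq; ring
    · rw [indicator_of_notMem hzK, sub_zero, mul_comm]
      have : 0 ≤ (layerMap p N '' K).indicator (fun y => F y ^ 2) (layerMap p N z) :=
        indicator_nonneg (fun y _ => sq_nonneg _) _
      nlinarith
  · have h3 : F y = 0 := pushforward_of_notMem f hy
    have h4 : (layerMap p N '' K).indicator (fun y => F y ^ 2) y = 0 := by
      simp [h3]
    rw [h3, h4]
    simp

end TestFunctions

/-! ### Transfer to the layer -/

section Transfer

variable {S : Type*} [TopologicalSpace S] [ChartedSpace E2 S] [IsManifold (𝓡 2) ∞ S]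
  {p N : S → E3} {a : ℝ}

theorem differential_eq_comp (h : IsQuantumLayer p N a) {f : S × ℝ → ℝ}
    (hf : IsTestFunction a f) {z : S × ℝ} (hz : z ∈ openLayer S a) :
    differential f z =
      (fderiv ℝ (pushforward p N a f) (layerMap p N z)).comp (layerDeriv p N z) :=
  (hasMFDerivAt_of_pushforward h hf.contMDiff hz).mfderiv

/-- The isometry `dp̃` carries the Riemannian gradient to the Euclidean one. -/
theorem gradientVector_eq (h : IsQuantumLayer p N a) {f : S × ℝ → ℝ}
    (hf : IsTestFunction a f) {z : S × ℝ} (hz : z ∈ openLayer S a) :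
    gradientVector p N f z = (InnerProductSpace.toDual ℝ E3).symm
      (fderiv ℝ (pushforward p N a f) (layerMap p N z)) := by
  obtain ⟨e, he⟩ := exists_layerDeriv_equiv (h.immersion z (openLayer_subset_layer S a hz))
  rw [gradientVector, layerGradient, differential_eq_comp h hf hz, he,
    ContinuousLinearMap.inverse_equiv]
  simp [ContinuousLinearMap.comp_assoc]

omit [IsManifold (𝓡 2) ∞ S] in
theorem IsTestFunction.add {f g : S × ℝ → ℝ} (hf : IsTestFunction a f) (hg : IsTestFunction a g) :
    IsTestFunction a (f + g) where
  contMDiff := hf.contMDiff.add hg.contMDiff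
  hasCompactSupport := hf.hasCompactSupport.add hg.hasCompactSupport
  tsupport_subset := (tsupport_add f g).trans (union_subset hf.tsupport_subset hg.tsupport_subset)

omit [IsManifold (𝓡 2) ∞ S] in
theorem IsTestFunction.const_smul {f : S × ℝ → ℝ} (hf : IsTestFunction a f) (c : ℝ) :
    IsTestFunction a (c • f) where
  contMDiff := (contDiff_const_smul c).contMDiff.comp hf.contMDiff
  hasCompactSupport := hf.hasCompactSupport.smul_left (f := fun _ => c)
  tsupport_subset := (tsupport_smul_subset_right (fun _ => c) f).trans hf.tsupport_subset

omit [IsManifold (𝓡 2) ∞ S] in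
theorem gradientVector_add {f g : S × ℝ → ℝ} (hf : IsTestFunction a f) (hg : IsTestFunction a g)
    (z : S × ℝ) :
    gradientVector p N (f + g) z = gradientVector p N f z + gradientVector p N g z := by
  have h1 : differential (f + g) z = differential f z + differential g z :=
    ((hf.contMDiff.mdifferentiable (by simp) z).hasMFDerivAt.add
      (hg.contMDiff.mdifferentiable (by simp) z).hasMFDerivAt).mfderiv
  simp only [gradientVector, layerGradient, h1, ContinuousLinearMap.add_comp, map_add]

omit [IsManifold (𝓡 2) ∞ S] in
theorem gradientVector_const_smul {f : S × ℝ → ℝ} (hf : IsTestFunction a f) (c : ℝ) (z : S × ℝ) :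
    gradientVector p N (c • f) z = c • gradientVector p N f z := by
  have h1 : differential (c • f) z = c • differential f z :=
    ((hf.contMDiff.mdifferentiable (by simp) z).hasMFDerivAt.const_smul c).mfderiv
  simp only [gradientVector, layerGradient, h1, ContinuousLinearMap.smul_comp, map_smul]

omit [IsManifold (𝓡 2) ∞ S] in
theorem gradientVector_zero (z : S × ℝ) : gradientVector p N (0 : S × ℝ → ℝ) z = 0 := by
  have h1 : differential (0 : S × ℝ → ℝ) z = 0 := mfderiv_const
  simp [gradientVector, layerGradient, h1]

variable [MeasurableSpace S]

omit [IsManifold (𝓡 2) ∞ S] in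
/-- The pairs `(f, ∇f)` form a linear subspace. -/
theorem span_testPairs (p N : S → E3) (a : ℝ) :
    (Submodule.span ℝ (testPairs p N a) : Set (L2 p N a × L2Vec p N a)) = testPairs p N a := by
  let W : Submodule ℝ (L2 p N a × L2Vec p N a) :=
    { carrier := testPairs p N a
      add_mem' := by
        rintro q r ⟨f, hf, hq1, hq2⟩ ⟨g, hg, hr1, hr2⟩
        refine ⟨f + g, hf.add hg, ?_, ?_⟩
        · exact (Lp.coeFn_add q.1 r.1).trans (hq1.add hr1)
        · refine (Lp.coeFn_add q.2 r.2).trans ((hq2.add hr2).trans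
            (Eventually.of_forall fun z => ?_))
          exact (gradientVector_add hf hg z).symm
      zero_mem' := by
        refine ⟨0, ⟨contMDiff_const, HasCompactSupport.zero, by simp [tsupport]⟩,
          Lp.coeFn_zero _ _ _, ?_⟩
        refine (Lp.coeFn_zero _ _ _).trans (Eventually.of_forall fun z => ?_)
        exact (gradientVector_zero z).symm
      smul_mem' := by
        rintro c q ⟨f, hf, hq1, hq2⟩
        refine ⟨c • f, hf.const_smul c, ?_, ?_⟩
        · exact (Lp.coeFn_smul c q.1).trans (hq1.const_smul c)
        · refine (Lp.coeFn_smul c q.2).trans ((hq2.const_smul c).trans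
            (Eventually.of_forall fun z => ?_))
          exact (gradientVector_const_smul hf c z).symm }
  exact congrArg
    (fun V : Submodule ℝ (L2 p N a × L2Vec p N a) => (V : Set (L2 p N a × L2Vec p N a)))
    (Submodule.span_eq W)

omit [IsManifold (𝓡 2) ∞ S] in
theorem coe_sobolevZero (p N : S → E3) (a : ℝ) :
    (sobolevZero p N a : Set (L2 p N a × L2Vec p N a)) = closure (testPairs p N a) := by
  rw [sobolevZero, Submodule.topologicalClosure_coe, span_testPairs]

omit [IsManifold (𝓡 2) ∞ S] in
theorem mem_dirichletLaplacian_iff (u w : L2 p N a) :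
    (u, w) ∈ dirichletLaplacian p N a ↔
      ∃ v, (u, v) ∈ sobolevZero p N a ∧ ∀ g ∈ sobolevZero p N a, ⟪v, g.2⟫ = ⟪w, g.1⟫ := by
  constructor
  · rintro ⟨v, hv, h⟩
    refine ⟨v, hv, fun g hg => ?_⟩
    rw [← SetLike.mem_coe, coe_sobolevZero] at hg
    exact closure_minimal (t := {g : L2 p N a × L2Vec p N a | ⟪v, g.2⟫ = ⟪w, g.1⟫}) h
      (isClosed_eq (by fun_prop) (by fun_prop)) hg
  · rintro ⟨v, hv, h⟩
    refine ⟨v, hv, fun g hg => h g ?_⟩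
    rw [← SetLike.mem_coe, coe_sobolevZero]
    exact subset_closure hg

variable [BorelSpace S]

omit [ChartedSpace E2 S] [IsManifold (𝓡 2) ∞ S] in
theorem ae_mem_openLayer (p N : S → E3) (a : ℝ) : ∀ᵐ z ∂layerVolume p N a, z ∈ openLayer S a := by
  refine (ae_map_iff measurable_subtype_coe.aemeasurable
    (isOpen_openLayer S a).measurableSet).mpr ?_
  exact Eventually.of_forall fun z => z.2

/-- `p̃` preserves the volume. -/
theorem map_layerVolume (h : IsQuantumLayer p N a) :
    (layerVolume p N a).map (layerMap p N) = volume.restrict (layerMap p N '' openLayer S a) := by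
  have hP : Measurable (layerMap p N) := (contMDiff_layerMap h).continuous.measurable
  rw [layerVolume, Measure.map_map hP measurable_subtype_coe, ← Set.range_domRestrict]
  exact (isOpenEmbedding_layerMap h).measurableEmbedding.map_comap _

theorem setIntegral_comp_layerMap (h : IsQuantumLayer p N a) {G : E3 → ℝ} (hG : Continuous G)
    (hGU : ∀ y ∉ layerMap p N '' openLayer S a, G y = 0) {s : Set E3} (hs : MeasurableSet s) :
    ∫ z in layerMap p N ⁻¹' s, G (layerMap p N z) ∂layerVolume p N a = ∫ y in s, G y := by
  have hP : Measurable (layerMap p N) := (contMDiff_layerMap h).continuous.measurable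
  rw [← setIntegral_map hs hG.aestronglyMeasurable hP.aemeasurable, map_layerVolume h,
    Measure.restrict_restrict hs]
  refine (setIntegral_eq_of_subset_of_forall_sdiff_eq_zero hs inter_subset_left fun y hy => ?_).symm
  exact hGU y fun hy' => hy.2 ⟨hy.1, hy'⟩

theorem integral_comp_layerMap (h : IsQuantumLayer p N a) {G : E3 → ℝ} (hG : Continuous G)
    (hGU : ∀ y ∉ layerMap p N '' openLayer S a, G y = 0) :
    ∫ z, G (layerMap p N z) ∂layerVolume p N a = ∫ y, G y := by
  simpa using setIntegral_comp_layerMap h hG hGU MeasurableSet.univ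

theorem integral_sq_eq (h : IsQuantumLayer p N a) {f : S × ℝ → ℝ} (hf : IsTestFunction a f) :
    ∫ z, f z ^ 2 ∂layerVolume p N a = ∫ y, pushforward p N a f y ^ 2 := by
  rw [← integral_comp_layerMap h (G := fun y => pushforward p N a f y ^ 2)
    ((contDiff_pushforward h hf).continuous.pow 2)
    fun y hy => by rw [pushforward_of_notMem f hy]; simp]
  refine integral_congr_ae ?_
  filter_upwards [ae_mem_openLayer p N a] with z hz
  rw [pushforward_layerMap h f hz]

theorem setIntegral_eq (h : IsQuantumLayer p N a) {f : S × ℝ → ℝ} (hf : IsTestFunction a f)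
    {s : Set E3} (hs : MeasurableSet s) :
    ∫ z in layerMap p N ⁻¹' s, f z ∂layerVolume p N a = ∫ y in s, pushforward p N a f y := by
  rw [← setIntegral_comp_layerMap h (contDiff_pushforward h hf).continuous
    (fun y hy => pushforward_of_notMem f hy) hs]
  refine integral_congr_ae (ae_restrict_of_ae ?_)
  filter_upwards [ae_mem_openLayer p N a] with z hz
  rw [pushforward_layerMap h f hz]

theorem integral_norm_gradientVector_sq (h : IsQuantumLayer p N a) {f : S × ℝ → ℝ}
    (hf : IsTestFunction a f) :
    ∫ z, ‖gradientVector p N f z‖ ^ 2 ∂layerVolume p N a =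
      ∫ y, ‖fderiv ℝ (pushforward p N a f) y‖ ^ 2 := by
  rw [← integral_comp_layerMap h (G := fun y => ‖fderiv ℝ (pushforward p N a f) y‖ ^ 2)
    (((contDiff_pushforward h hf).continuous_fderiv one_ne_zero).norm.pow 2) fun y hy => ?_]
  · refine integral_congr_ae ?_
    filter_upwards [ae_mem_openLayer p N a] with z hz
    rw [gradientVector_eq h hf hz, LinearIsometryEquiv.norm_map]
  · have h1 : y ∉ tsupport (fderiv ℝ (pushforward p N a f)) := fun h1 =>
      hy (tsupport_pushforward_subset_image h hf (tsupport_fderiv_subset ℝ h1))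
    rw [image_eq_zero_of_notMem_tsupport h1]
    simp

/-- Below `π² / (4 a²)`, the Dirichlet form is bounded below on a subspace of finite codimension. -/
theorem exists_form_bound (h : IsQuantumLayer p N a) (hflat : AsymptoticallyFlat p N)
    {c₁ : ℝ} (hc₀ : 0 < c₁) (hc₁ : c₁ < Real.pi ^ 2 / (4 * a ^ 2)) :
    ∃ E : Submodule ℝ (L2 p N a), FiniteDimensional ℝ E ∧
      ∀ q ∈ sobolevZero p N a, q.1 ∈ Eᗮ → c₁ * ‖q.1‖ ^ 2 ≤ ‖q.2‖ ^ 2 := by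
  obtain ⟨c₂, hc₁₂, hc₂⟩ := exists_between hc₁
  obtain ⟨K, M, hK, -, hM, hKM⟩ := exists_dirichlet_lower_bound h hflat hc₂
  have hP : Continuous (layerMap p N) := (contMDiff_layerMap h).continuous
  -- The relative error `M ε` of averaging over cubes is absorbed by the gap between `c₁` and `c₂`.
  let ε := (c₂ / c₁ - 1) / (M + 1)
  have hε : 0 < ε := div_pos (by rw [sub_pos, one_lt_div hc₀]; exact hc₁₂) (by linarith)
  have hMε : M * ε ≤ c₂ / c₁ - 1 := by
    calc M * ε ≤ (M + 1) * ε := by gcongr; linarith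
      _ = _ := by simp only [ε]; field_simp
  obtain ⟨C, n, s, hn, hcubes⟩ :=
    exists_cubes_setIntegral_sq_le (hK.image hP).isBounded hε
  have hms : ∀ ν, MeasurableSet (layerMap p N ⁻¹' cube n ν) := fun ν =>
    hP.measurable (measurableSet_cube ν)
  have hfin : ∀ ν, layerVolume p N a (layerMap p N ⁻¹' cube n ν) ≠ ⊤ := fun ν => by
    rw [← Measure.map_apply hP.measurable (measurableSet_cube ν), map_layerVolume h]
    refine ((Measure.restrict_apply_le _ _).trans_lt ?_).ne
    rw [volume_cube hn]
    exact ENNReal.ofReal_lt_top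
  let e : (Fin 3 → ℤ) → L2 p N a := fun ν => indicatorConstLp 2 (hms ν) (hfin ν) 1
  have htest : ∀ q ∈ testPairs p N a, c₂ * ‖q.1‖ ^ 2 ≤
      (1 + M * ε) * ‖q.2‖ ^ 2 + M * (C * ∑ ν ∈ s, ⟪e ν, q.1⟫ ^ 2) := by
    rintro q ⟨f, hf, hq1, hq2⟩
    have h1 : ‖q.1‖ ^ 2 = ∫ y, pushforward p N a f y ^ 2 := by
      rw [← real_inner_self_eq_norm_sq, L2.inner_def, ← integral_sq_eq h hf]
      refine integral_congr_ae ?_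
      filter_upwards [hq1] with z hz
      rw [hz, real_inner_self_eq_norm_sq, Real.norm_eq_abs, sq_abs]
    have h2 : ‖q.2‖ ^ 2 = ∫ y, ‖fderiv ℝ (pushforward p N a f) y‖ ^ 2 := by
      rw [← real_inner_self_eq_norm_sq, L2.inner_def, ← integral_norm_gradientVector_sq h hf]
      refine integral_congr_ae ?_
      filter_upwards [hq2] with z hz
      rw [hz, real_inner_self_eq_norm_sq]
    have h3 : ∀ ν, ⟪e ν, q.1⟫ = ∫ y in cube n ν, pushforward p N a f y := fun ν => by
      rw [L2.inner_indicatorConstLp_one, ← setIntegral_eq h hf (measurableSet_cube ν)]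
      exact integral_congr_ae (ae_restrict_of_ae hq1)
    have h4 := hKM f hf
    have h5 := hcubes _ (contDiff_pushforward h hf) (hasCompactSupport_pushforward h hf)
    simp only [h1, h2, h3]
    nlinarith [mul_le_mul_of_nonneg_left h5 hM]
  have hclosed : IsClosed {q : L2 p N a × L2Vec p N a | c₂ * ‖q.1‖ ^ 2 ≤
      (1 + M * ε) * ‖q.2‖ ^ 2 + M * (C * ∑ ν ∈ s, ⟪e ν, q.1⟫ ^ 2)} :=
    isClosed_le (by fun_prop) (by fun_prop)
  refine ⟨Submodule.span ℝ (e '' s), FiniteDimensional.span_of_finite ℝ (s.finite_toSet.image e),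
    fun q hq hqE => ?_⟩
  rw [← SetLike.mem_coe, coe_sobolevZero] at hq
  have h1 : c₂ * ‖q.1‖ ^ 2 ≤ (1 + M * ε) * ‖q.2‖ ^ 2 + M * (C * ∑ ν ∈ s, ⟪e ν, q.1⟫ ^ 2) :=
    closure_minimal htest hclosed hq
  have h2 : ∑ ν ∈ s, ⟪e ν, q.1⟫ ^ 2 = 0 := Finset.sum_eq_zero fun ν hν => by
    rw [hqE _ (Submodule.subset_span ⟨ν, hν, rfl⟩)]
    simp
  rw [h2, mul_zero, mul_zero, add_zero] at h1
  have h3 : c₂ * ‖q.1‖ ^ 2 ≤ c₂ / c₁ * ‖q.2‖ ^ 2 :=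
    h1.trans (mul_le_mul_of_nonneg_right (by linarith) (sq_nonneg _))
  rw [div_mul_eq_mul_div, le_div_iff₀ hc₀] at h3
  refine le_of_mul_le_mul_left ?_ (hc₀.trans hc₁₂)
  linarith

/-- On test functions supported away from a large compact set, Rayleigh quotients are almost
bounded below by `π² / (4 a²)`. -/
theorem exists_compact_le_rayleighQuotient (h : IsQuantumLayer p N a)
    (hflat : AsymptoticallyFlat p N) {c₁ : ℝ} (hc₁ : c₁ < Real.pi ^ 2 / (4 * a ^ 2)) :
    ∃ K : Set (S × ℝ), IsCompact K ∧ K ⊆ layer S a ∧ ∀ f, IsTestFunction a f →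
      Disjoint (tsupport f) K → f ≠ 0 → c₁ ≤ rayleighQuotient p N a f := by
  obtain ⟨K, M, hK, hKl, hM, hKM⟩ := exists_dirichlet_lower_bound h hflat hc₁
  refine ⟨K, hK, hKl, fun f hf hfK hf0 => ?_⟩
  set F := pushforward p N a f with hF
  have hFK : ∀ y ∈ layerMap p N '' K, F y = 0 := by
    rintro _ ⟨z, hz, rfl⟩
    by_cases hy : layerMap p N z ∈ layerMap p N '' openLayer S a
    · obtain ⟨z', hz', hzz'⟩ := hy
      have h1 : z' = z := congrArg Subtype.val (h.embedding.injective
        (a₁ := ⟨z', openLayer_subset_layer S a hz'⟩) (a₂ := ⟨z, hKl hz⟩) hzz')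
      rw [h1] at hz'
      rw [hF, pushforward_layerMap h f hz']
      exact image_eq_zero_of_notMem_tsupport fun h2 => Set.disjoint_left.mp hfK h2 hz
    · exact pushforward_of_notMem f hy
  have hKm : MeasurableSet (layerMap p N '' K) :=
    (hK.image (contMDiff_layerMap h).continuous).isClosed.measurableSet
  have h1 := hKM f hf
  rw [setIntegral_eq_zero_of_forall_eq_zero (fun y hy => by rw [← hF, hFK y hy]; simp), mul_zero,
    add_zero] at h1
  have hpos : 0 < ∫ y, F y ^ 2 := by
    obtain ⟨z, hz⟩ := Function.ne_iff.mp hf0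
    have hzW := hf.tsupport_subset (subset_tsupport f hz)
    refine Continuous.integral_pos_of_hasCompactSupport_nonneg_nonzero (x := layerMap p N z)
      ((contDiff_pushforward h hf).continuous.pow 2)
      ((hasCompactSupport_pushforward h hf).comp_left (g := fun t : ℝ => t ^ 2) (by simp))
      (fun y => sq_nonneg _) ?_
    rw [hF, pushforward_layerMap h f hzW]
    exact pow_ne_zero 2 hz
  have hnum : ∫ z, layerMetric p N z (layerGradient p N f z) (layerGradient p N f z)
      ∂layerVolume p N a = ∫ y, ‖fderiv ℝ F y‖ ^ 2 := by
    rw [← integral_norm_gradientVector_sq h hf]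
    refine integral_congr_ae (Eventually.of_forall fun z => ?_)
    exact real_inner_self_eq_norm_sq _
  rw [rayleighQuotient, hnum, integral_sq_eq h hf, le_div_iff₀ hpos]
  exact h1

end Transfer

end QuantumLayer

end

theorem lemma2p1 {S : Type*} [TopologicalSpace S] [ChartedSpace QuantumLayer.E2 S]
    [IsManifold (𝓡 2) ∞ S] [MeasurableSpace S] [BorelSpace S]
    (p N : S → QuantumLayer.E3) (a : ℝ)
    (hlayer : QuantumLayer.IsQuantumLayer p N a)
    (hflat : QuantumLayer.AsymptoticallyFlat p N) :
    ((Real.pi ^ 2 / (4 * a ^ 2) : ℝ) : EReal) ≤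
        QuantumLayer.bottomEssentialSpectrum (QuantumLayer.dirichletLaplacian p N a) ∧
      ((Real.pi ^ 2 / (4 * a ^ 2) : ℝ) : EReal) ≤ QuantumLayer.variationalSigmaEss p N a := by
  have ha := hlayer.pos
  have hpi := Real.pi_pos
  constructor
  · refine le_iInf₂ fun c hc => ?_
    rw [EReal.coe_le_coe_iff]
    by_contra! hlt
    obtain ⟨c₁, hcc₁, hc₁⟩ := exists_between
      (max_lt hlt (by positivity : (0 : ℝ) < Real.pi ^ 2 / (4 * a ^ 2)))
    have hc₀ : 0 < c₁ := (le_max_right _ _).trans_lt hcc₁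
    obtain ⟨E, hE, hform⟩ := QuantumLayer.exists_form_bound hlayer hflat hc₀ hc₁
    exact hc.2 (QuantumLayer.mem_discreteSpectrum_of_form_bound (QuantumLayer.sobolevZero p N a)
      (Submodule.isClosed_topologicalClosure _) _ QuantumLayer.mem_dirichletLaplacian_iff E
      ((le_max_left _ _).trans_lt hcc₁) hc₀ hform hc.1)
  · refine EReal.ge_of_forall_gt_iff_ge.mp fun c₁ hc₁ => ?_
    rw [EReal.coe_lt_coe_iff] at hc₁
    obtain ⟨K, hK, hKl, hray⟩ :=
      QuantumLayer.exists_compact_le_rayleighQuotient hlayer hflat hc₁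
    refine le_iSup_of_le ⟨K, hK, hKl⟩ (le_iInf fun f => ?_)
    rw [EReal.coe_le_coe_iff]
    exact hray f.1 f.2.1 f.2.2.1 f.2.2.2
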